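/- Let $m\ge 1$. For two real random variables $A,B$ on a probability space with measure $\mathbb P$ write $A\le_{\mathrm{st}}B$ if $\mathbb P(A>t)\le \mathbb P(B>t)$ for all $t\in\mathbb R$. Consider either of the following two models, given by a family $(\mathbb P_\vartheta)_{\vartheta\in\Theta}$ of probability measures on one measurable space and random variables on it. **Multiple $Z$-tests model.** The data are $X=(X_{i,j}:1\le i\le n_j,\ 1\le j\le m)$ with $n_j\ge 1$, and the parameter vector is $\vartheta=(\vartheta_1,\dots,\vartheta_m)\in\mathbb R^m$. Under $\mathbb P_\vartheta$, for each $j$ the variables $X_{1,j},\dots,X_{n_j,j}$ are i.i.d. $N(\vartheta_j,1)$. Put $\theta_j(\vartheta)=\vartheta_j$, $T_j=n_j^{-1}\sum_{i=1}^{n_j}X_{i,j}$, and $\Gamma_j(\alpha)=(F_j^{-1}(1-\alpha),\infty)$ for $\alpha\in(0,1)$, where $F_j$ is the cdf of $N(0,n_j^{-1})$. **Two-sample means comparison model.** The data $X$ consist of $X_{1,j},\dots,X_{n_{1,j},j}$ and $Y_{1,j},\dots,Y_{n_{2,j},j}$ for $1\le j\le m$, with $n_{1,j},n_{2,j}\ge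 1$ and $n_{1,j}+n_{2,j}\ge 3$. The parameter $\vartheta$ consists of $\theta_{1,j},\theta_{2,j}\in\mathbb R$ and $\sigma_j^2>0$ for $1\le j\le m$, all of them unknown and unrestricted. Under $\mathbb P_\vartheta$, for each $j$ these $n_{1,j}+n_{2,j}$ variables are jointly independent with $X_{i,j}\sim N(\theta_{1,j},\sigma_j^2)$ and $Y_{i,j}\sim N(\theta_{2,j},\sigma_j^2)$. Put $\theta_j(\vartheta)=\theta_{1,j}-\theta_{2,j}$, let $\bar X_j,\bar Y_j$ be the sample means, and put $$S_j^2=\frac{1}{n_{1,j}+n_{2,j}-2}\Big[\sum_{i=1}^{n_{1,j}}(X_{i,j}-\bar X_j)^2+\sum_{i=1}^{n_{2,j}}(Y_{i,j}-\bar Y_j)^2\Big],\qquad T_j=\sqrt{\frac{n_{1,j}n_{2,j}}{n_{1,j}+n_{2,j}}}\;\frac{\bar X_j-\bar Y_j}{S_j},\quad S_j=\sqrt{S_j^2},$$ and $\Gamma_j(\alpha)=(F_j^{-1}(1-\alpha),\infty)$ for $\alpha\in(0,1)$, where $F_j$ is the cdf of Student's $t$-distribution with $n_{1,j}+n_{2,j}-2$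 degrees of freedom. In both models the dependence between different coordinates $j$ is arbitrary (it may be governed by an additional nuisance parameter, which is then a further component of $\vartheta$). The null hypothesis is $H_j:\theta_j(\vartheta)\le 0$ and the alternative is $K_j:\theta_j(\vartheta)>0$. The LFC-based $p$-value is $$p_j^{LFC}(X)=\inf_{\tilde\alpha\in(0,1):\,T_j\in\Gamma_j(\tilde\alpha)}\ \ \sup_{\vartheta:\,\theta_j(\vartheta)\le 0}\mathbb P_\vartheta\big(T_j\in\Gamma_j(\tilde\alpha)\big).$$ Let $U_1,\dots,U_m$ be random variables on the same space that, under every $\mathbb P_\vartheta$, are independent, uniformly distributed on $[0,1]$, and jointly independent of the data $X$. For $c\in(0,1]$ put $$p_j^{rand}(X,U_j,c)=U_j\mathbf 1\{p_j^{LFC}(X)\ge c\}+p_j^{LFC}(X)\,c^{-1}\,\mathbf 1\{p_j^{LFC}(X)<c\},$$ and $p_j^{rand}(X,U_j,0)=U_j$. **Statement.** In each of the two models, for every $j\in\{1,\dots,m\}$ and every $c_j\in[0,1]$: 1. under every $\mathbb P_\vartheta$ with $\theta_j(\vartheta)\le 0$, $$U_j\le_{\mathrm{st}}p_j^{rand}(X,U_j,c_j)\le_{\mathrm{st}}p_j^{LFC}(X);$$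 2. under every $\mathbb P_\vartheta$ with $\theta_j(\vartheta)>0$, $$p_j^{LFC}(X)\le_{\mathrm{st}}p_j^{rand}(X,U_j,c_j)\le_{\mathrm{st}}U_j.$$ -/

import Mathlib

open MeasureTheory ProbabilityTheory
open scoped NNReal

noncomputable section

/-- Usual stochastic order `A ≤_st B` of two real random variables under the probability
measure `P`: `P(A > t) ≤ P(B > t)` for every real `t`. -/
def StochLE {Ω : Type*} [MeasurableSpace Ω] (P : Measure Ω) (A B : Ω → ℝ) : Prop :=
  ∀ t : ℝ, P {ω | t < A ω} ≤ P {ω | t < B ω}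

/-- The quantile `F⁻¹(u) = inf {x | u ≤ F(x)}` of the distribution `μ`, where
`F(x) = μ((-∞, x])`. -/
def quantile (μ : Measure ℝ) (u : ℝ) : ℝ :=
  sInf {x : ℝ | u ≤ μ.real (Set.Iic x)}

/-- One-sided rejection region `Γ(α) = (F⁻¹(1 - α), ∞)`, where `F` is the distribution function
of `μ`. -/
def upperRegion (μ : Measure ℝ) (α : ℝ) : Set ℝ :=
  Set.Ioi (quantile μ (1 - α))

/-- The chi-square distribution with `k` degrees of freedom: the law of the sum of the squares
of `k` independent standard normal variables. -/
def chiSquareMeasure (k : ℕ) : Measure ℝ :=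
  (Measure.pi fun _ : Fin k => gaussianReal 0 1).map fun z => ∑ i, z i ^ 2

/-- Student's `t`-distribution with `k` degrees of freedom (used for `k ≥ 1`): the law of
`Z / √(V / k)` with independent `Z ∼ N(0, 1)` and `V ∼ χ²_k`. -/
def studentTMeasure (k : ℕ) : Measure ℝ :=
  ((gaussianReal 0 1).prod (chiSquareMeasure k)).map fun q => q.1 / √(q.2 / k)

/-- The LFC-based `p`-value
`inf {sup {P_ϑ(T ∈ Γ(a)) : ϑ in the null hypothesis} : a ∈ (0, 1), T(ω) ∈ Γ(a)}`
for the family `P`, the set `null` of those parameters that satisfy the null hypothesis, the test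
statistic `T` (a function of `ω` through the data), and the rejection regions `Γ`. -/
def pLFC {Θ Ω : Type*} [MeasurableSpace Ω] (P : Θ → Measure Ω) (null : Set Θ) (T : Ω → ℝ)
    (Γ : ℝ → Set ℝ) (ω : Ω) : ℝ :=
  sInf ((fun a : ℝ => sSup ((fun ϑ => (P ϑ).real {ω' | T ω' ∈ Γ a}) '' null)) ''
    {a : ℝ | a ∈ Set.Ioo (0 : ℝ) 1 ∧ T ω ∈ Γ a})

/-- The randomized `p`-value `u · 1{p ≥ c} + p c⁻¹ · 1{p < c}`, which is `u` for `c = 0` by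
convention. -/
def pRand (p u c : ℝ) : ℝ :=
  if c = 0 then u else if c ≤ p then u else p * c⁻¹

/-- Under `P`, the variables `U j` are independent, uniformly distributed on `[0, 1]`, and (jointly)
independent of the data `D`. -/
structure IsRandomizer {Ω 𝓧 : Type*} [MeasurableSpace Ω] [MeasurableSpace 𝓧] {m : ℕ}
    (P : Measure Ω) (D : Ω → 𝓧) (U : Fin m → Ω → ℝ) : Prop where
  measurable : ∀ j, Measurable (U j)
  uniform : ∀ j, P.map (U j) = volume.restrict (Set.Icc (0 : ℝ) 1)
  iIndep : iIndepFun U P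
  indep_data : IndepFun D (fun ω j => U j ω) P

/-! ### Multiple `Z`-tests model -/

/-- The multiple `Z`-tests model: `m` samples, the `j`-th of size `n j ≥ 1`, i.i.d. `N(ϑ_j, 1)`.
A parameter is a pair `(ϑ, η)` of the vector `ϑ ∈ ℝ^m` and a nuisance parameter `η : N`
on which only the dependence between different samples can depend; that dependence is
not restricted (take a one-point `N` for the parameter space `ℝ^m`). -/
structure IsZTestsModel {Ω N : Type*} [MeasurableSpace Ω] {m : ℕ} (n : Fin m → ℕ)
    (P : (Fin m → ℝ) × N → Measure Ω) (X : (j : Fin m) → Fin (n j) → Ω → ℝ) : Prop where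
  size_pos : ∀ j, 1 ≤ n j
  isProb : ∀ ϑ, IsProbabilityMeasure (P ϑ)
  measurable : ∀ j i, Measurable (X j i)
  iIndep : ∀ ϑ j, iIndepFun (X j) (P ϑ)
  law : ∀ ϑ j i, (P ϑ).map (X j i) = gaussianReal (ϑ.1 j) 1

/-- Mean of a finite sample, as a function of `ω`. -/
def sampleMean {Ω : Type*} {k : ℕ} (X : Fin k → Ω → ℝ) (ω : Ω) : ℝ :=
  (k : ℝ)⁻¹ * ∑ i, X i ω

/-- LFC-based `p`-value of the `j`-th `Z`-test, `H_j : ϑ_j ≤ 0`; the statistic is the sample mean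
and the rejection region is `(Φ_{(0, 1/n_j)}⁻¹(1 - α), ∞)`. -/
def zPLFC {Ω N : Type*} [MeasurableSpace Ω] {m : ℕ} (n : Fin m → ℕ)
    (P : (Fin m → ℝ) × N → Measure Ω) (X : (j : Fin m) → Fin (n j) → Ω → ℝ) (j : Fin m) :
    Ω → ℝ :=
  pLFC P {ϑ | ϑ.1 j ∈ Set.Iic (0 : ℝ)} (sampleMean (X j))
    (upperRegion (gaussianReal 0 (n j : ℝ≥0)⁻¹))

/-! ### Two-sample means comparison model -/

/-- Parameters of the two-sample model: the means of both samples and the common positive variance,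
for each of the `m` coordinates. -/
structure TwoSampleParam (m : ℕ) where
  mean₁ : Fin m → ℝ
  mean₂ : Fin m → ℝ
  var : Fin m → ℝ≥0
  var_pos : ∀ j, 0 < var j

/-- The derived parameter `θ_j = θ_{1,j} - θ_{2,j}`. -/
def TwoSampleParam.diff {m : ℕ} (ϑ : TwoSampleParam m) (j : Fin m) : ℝ :=
  ϑ.mean₁ j - ϑ.mean₂ j

/-- The two-sample means comparison model: for each `j`, the variables `X j i ∼ N(θ_{1,j}, σ²_j)`
and `Y j i ∼ N(θ_{2,j}, σ²_j)` are jointly independent; the sample sizes are positive and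
such that there is at least one degree of freedom. The dependence between different `j` is not
restricted and can depend on a nuisance parameter in `N`. -/
structure IsTwoSampleModel {Ω N : Type*} [MeasurableSpace Ω] {m : ℕ} (n₁ n₂ : Fin m → ℕ)
    (P : TwoSampleParam m × N → Measure Ω) (X : (j : Fin m) → Fin (n₁ j) → Ω → ℝ)
    (Y : (j : Fin m) → Fin (n₂ j) → Ω → ℝ) : Prop where
  size₁_pos : ∀ j, 1 ≤ n₁ j
  size₂_pos : ∀ j, 1 ≤ n₂ j
  df_pos : ∀ j, 3 ≤ n₁ j + n₂ j
  isProb : ∀ ϑ, IsProbabilityMeasure (P ϑ)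
  measurable_X : ∀ j i, Measurable (X j i)
  measurable_Y : ∀ j i, Measurable (Y j i)
  iIndep : ∀ ϑ j, iIndepFun (Sum.elim (X j) (Y j) : Fin (n₁ j) ⊕ Fin (n₂ j) → Ω → ℝ) (P ϑ)
  law_X : ∀ ϑ j i, (P ϑ).map (X j i) = gaussianReal (ϑ.1.mean₁ j) (ϑ.1.var j)
  law_Y : ∀ ϑ j i, (P ϑ).map (Y j i) = gaussianReal (ϑ.1.mean₂ j) (ϑ.1.var j)

/-- Pooled sample variance of two samples. -/
def pooledVar {Ω : Type*} {k l : ℕ} (X : Fin k → Ω → ℝ) (Y : Fin l → Ω → ℝ) (ω : Ω) : ℝ :=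
  1 / ((k : ℝ) + l - 2) *
    (∑ i, (X i ω - sampleMean X ω) ^ 2 + ∑ i, (Y i ω - sampleMean Y ω) ^ 2)

/-- Two-sample `t`-statistic, normalized by the pooled standard deviation. -/
def tStat {Ω : Type*} {k l : ℕ} (X : Fin k → Ω → ℝ) (Y : Fin l → Ω → ℝ) (ω : Ω) : ℝ :=
  √((k : ℝ) * l / (k + l)) * (sampleMean X ω - sampleMean Y ω) / √(pooledVar X Y ω)

/-- LFC-based `p`-value of the `j`-th two-sample `t`-test, `H_j : θ_{1,j} - θ_{2,j} ≤ 0`, with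
rejection region given by the quantiles of `t_{n₁ + n₂ - 2}`. -/
def tPLFC {Ω N : Type*} [MeasurableSpace Ω] {m : ℕ} (n₁ n₂ : Fin m → ℕ)
    (P : TwoSampleParam m × N → Measure Ω) (X : (j : Fin m) → Fin (n₁ j) → Ω → ℝ)
    (Y : (j : Fin m) → Fin (n₂ j) → Ω → ℝ) (j : Fin m) : Ω → ℝ :=
  pLFC P {ϑ | ϑ.1.diff j ∈ Set.Iic (0 : ℝ)} (tStat (X j) (Y j))
    (upperRegion (studentTMeasure (n₁ j + n₂ j - 2)))

end

/-! Let `μ` be the law of the statistic `T` at the boundary of the null hypothesis. The null laws of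
`T` are stochastically below `μ`, and `μ` is attained, so the LFC-based p-value is `V = upperTail μ
(T)` (`pLFC_upperRegion`). Let `H` be the distribution function of `V` under a given parameter. By
independence of `V` and `U`, the randomized p-value exceeds `t ∈ [0, 1)` with probability `1 - t + t
H(c) - H(tc)`. Comparing this with `1 - t` and with `1 - H(t)` leaves two inequalities, between
`H(tc)` and `t H(c)`, and between `H(tc) + t` and `H(t) + t H(c)`. For concave `H` with `H(0) = 0`
and `H(1) = 1`, both hold in the direction needed under the alternative; for convex `H` they are
reversed, as needed under the null.

The shape of `H` comes from monotone likelihood ratios. Under `μ` the variable `upperTail μ` is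
uniform, so the slopes of `H` are ratios of the masses that the law of `T` and `μ` give to the same
interval. Small p-values correspond to large `T`, hence a likelihood ratio increasing in `T` makes
`H` concave and a decreasing one makes it convex.

It remains to check the likelihood ratios. For the `Z`-test, a shifted normal law is an exponential
tilt of the centered one. For the `t`-test, orthonormal coordinates show that `T` is noncentral `t`
(`map_tStat_eq_noncentralTMeasure`). Tilting the numerator `Z` by `exp(dZ - d²/2)`, writing `Z = R
sin(arctan(T/√k))` with `R` the norm of the Gaussian vector, and using that `R` is independent of
`T`, gives a density with respect to the central law that is monotone in the direction of the sign
of `d` (`noncentralTMeasure_eq_withDensity`). -/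

noncomputable section

open Set

/-! ### Monotone likelihood ratios -/

/-- `β` dominates `α` in the likelihood ratio order: in cross-multiplied form, `β / α` is larger
on sets to the right of a point than on sets to the left of that point. -/
def LikelihoodRatioLE (α β : Measure ℝ) : Prop :=
  ∀ (s : ℝ) (A B : Set ℝ), MeasurableSet A → MeasurableSet B → A ⊆ Iic s → B ⊆ Ici s →
    β A * α B ≤ α A * β B

/-- The constant `g s` separates the values of the density on the two sides of `s`. The
cross-multiplied form needs no division, so null sets and infinite values of `g` are harmless. -/
lemma likelihoodRatioLE_withDensity_of_monotone (μ : Measure ℝ) {g : ℝ → ENNReal}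
    (hg : Monotone g) : LikelihoodRatioLE μ (μ.withDensity g) := by
  intro s A B hA hB hAs hBs
  have h1 : μ.withDensity g A ≤ g s * μ A := by
    rw [withDensity_apply _ hA, ← setLIntegral_const]
    exact setLIntegral_mono' hA fun x hx => hg (hAs hx)
  have h2 : g s * μ B ≤ μ.withDensity g B := by
    rw [withDensity_apply _ hB, ← setLIntegral_const]
    exact setLIntegral_mono' hB fun x hx => hg (hBs hx)
  calc _ ≤ g s * μ A * μ B := by gcongr
    _ = μ A * (g s * μ B) := by ring
    _ ≤ _ := by gcongr

lemma likelihoodRatioLE_withDensity_of_antitone (μ : Measure ℝ) {g : ℝ → ENNReal}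
    (hg : Antitone g) : LikelihoodRatioLE (μ.withDensity g) μ := by
  intro s A B hA hB hAs hBs
  have h1 : g s * μ A ≤ μ.withDensity g A := by
    rw [withDensity_apply _ hA, ← setLIntegral_const]
    exact setLIntegral_mono' hA fun x hx => hg (hAs hx)
  have h2 : μ.withDensity g B ≤ g s * μ B := by
    rw [withDensity_apply _ hB, ← setLIntegral_const]
    exact setLIntegral_mono' hB fun x hx => hg (hBs hx)
  calc _ ≤ μ A * (g s * μ B) := by gcongr
    _ = g s * μ A * μ B := by ring
    _ ≤ _ := by gcongr

/-- The likelihood ratio order implies the usual stochastic order. -/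
lemma LikelihoodRatioLE.measure_Ioi_le {α β : Measure ℝ} [IsProbabilityMeasure α]
    [IsProbabilityMeasure β] (h : LikelihoodRatioLE α β) (q : ℝ) : α (Ioi q) ≤ β (Ioi q) := by
  have h1 := h q (Iic q) (Ioi q) measurableSet_Iic measurableSet_Ioi le_rfl Ioi_subset_Ici_self
  have ha : α (Iic q) = 1 - α (Ioi q) := by
    rw [← compl_Ioi, prob_compl_eq_one_sub measurableSet_Ioi]
  have hb : β (Iic q) = 1 - β (Ioi q) := by
    rw [← compl_Ioi, prob_compl_eq_one_sub measurableSet_Ioi]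
  rw [ha, hb, ENNReal.sub_mul (fun _ _ => measure_ne_top _ _),
    ENNReal.sub_mul (fun _ _ => measure_ne_top _ _), one_mul, one_mul, mul_comm (β _)] at h1
  have h2 : α (Ioi q) * β (Ioi q) ≤ α (Ioi q) := mul_le_of_le_one_right' prob_le_one
  have h3 : α (Ioi q) * β (Ioi q) ≤ β (Ioi q) := mul_le_of_le_one_left' prob_le_one
  -- With `a`, `b` the two tail masses, the cut at `q` gives `(1 - b) a ≤ (1 - a) b`. Subtraction in
  -- `ENNReal` is truncated, so `ab` is added back only after checking that it is below both masses.
  calc _ = α (Ioi q) - α (Ioi q) * β (Ioi q) + α (Ioi q) * β (Ioi q) := (tsub_add_cancel_of_le h2).symm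
    _ ≤ β (Ioi q) - α (Ioi q) * β (Ioi q) + α (Ioi q) * β (Ioi q) := by gcongr
    _ = _ := tsub_add_cancel_of_le h3

/-! ### Upper tail function of a continuous distribution with full support -/

/-- The upper tail probability `1 - F(x)`. -/
def upperTail (μ : Measure ℝ) (x : ℝ) : ℝ := μ.real (Ioi x)

section UpperTail

variable (μ : Measure ℝ) [IsProbabilityMeasure μ]

lemma upperTail_eq_one_sub (x : ℝ) : upperTail μ x = 1 - μ.real (Iic x) := by
  rw [upperTail, ← compl_Iic, probReal_compl_eq_one_sub measurableSet_Iic]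

lemma upperTail_sub_upperTail {x y : ℝ} (h : x ≤ y) :
    upperTail μ x - upperTail μ y = μ.real (Ioc x y) := by
  rw [upperTail, upperTail, ← Ioc_union_Ioi_eq_Ioi h,
    measureReal_union (Ioc_disjoint_Ioi le_rfl) measurableSet_Ioi]
  ring

lemma antitone_upperTail : Antitone (upperTail μ) := fun _ _ h =>
  measureReal_mono (Ioi_subset_Ioi h)

lemma measurable_upperTail : Measurable (upperTail μ) := (antitone_upperTail μ).measurable

lemma strictAnti_upperTail [μ.IsOpenPosMeasure] : StrictAnti (upperTail μ) := by
  intro x y h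
  rw [← sub_pos, upperTail_sub_upperTail μ h.le]
  refine lt_of_lt_of_le ?_ (measureReal_mono Ioo_subset_Ioc_self)
  exact ENNReal.toReal_pos (isOpen_Ioo.measure_pos μ (nonempty_Ioo.2 h)).ne' (measure_ne_top _ _)

lemma upperTail_pos [μ.IsOpenPosMeasure] (x : ℝ) : 0 < upperTail μ x :=
  lt_of_le_of_lt measureReal_nonneg (strictAnti_upperTail μ (lt_add_one x))

lemma upperTail_lt_one [μ.IsOpenPosMeasure] (x : ℝ) : upperTail μ x < 1 :=
  lt_of_lt_of_le (strictAnti_upperTail μ (sub_one_lt x)) measureReal_le_one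

lemma continuous_upperTail [NullSingletonClass μ] : Continuous (upperTail μ) := by
  have h : upperTail μ = fun x => 1 - cdf μ x := by
    ext x; rw [upperTail_eq_one_sub, cdf_eq_real]
  rw [h]
  refine continuous_const.sub (continuous_iff_continuousAt.2 fun x => ?_)
  rw [(monotone_cdf μ).continuousAt_iff_leftLim_eq_rightLim, StieltjesFunction.rightLim_eq]
  have h1 := (cdf μ).measure_singleton x
  rw [measure_cdf, measure_singleton, eq_comm, ENNReal.ofReal_eq_zero] at h1
  exact le_antisymm ((monotone_cdf μ).leftLim_le le_rfl) (by linarith)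

lemma exists_upperTail_eq [NullSingletonClass μ] {u : ℝ} (hu : u ∈ Ioo (0 : ℝ) 1) :
    ∃ x, upperTail μ x = u := by
  have h0 : Filter.Tendsto (upperTail μ) Filter.atTop (nhds 0) := by
    have h := (tendsto_cdf_atTop μ).const_sub 1
    simp only [sub_self, cdf_eq_real] at h
    exact h.congr fun x => (upperTail_eq_one_sub μ x).symm
  have h1 : Filter.Tendsto (upperTail μ) Filter.atBot (nhds 1) := by
    have h := (tendsto_cdf_atBot μ).const_sub 1
    simp only [sub_zero, cdf_eq_real] at h
    exact h.congr fun x => (upperTail_eq_one_sub μ x).symm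
  obtain ⟨a, ha⟩ := (h0.eventually (gt_mem_nhds hu.1)).exists
  obtain ⟨b, hb⟩ := (h1.eventually (lt_mem_nhds hu.2)).exists
  exact mem_range_of_exists_le_of_exists_ge (continuous_upperTail μ) ⟨a, ha.le⟩ ⟨b, hb.le⟩

lemma measureReal_upperTail_mem_Ioc (α : Measure ℝ) [IsProbabilityMeasure α] {x y : ℝ}
    (h : x ≤ y) : α.real {t | upperTail μ t ∈ Ioc x y} =
      α.real {t | upperTail μ t ≤ y} - α.real {t | upperTail μ t ≤ x} := by
  have hs : {t | upperTail μ t ≤ x} ⊆ {t | upperTail μ t ≤ y} := fun t ht => le_trans ht h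
  rw [← measureReal_sdiff hs (measurableSet_le (measurable_upperTail μ) measurable_const)]
  congr 1
  ext t
  simp [and_comm]

variable [NullSingletonClass μ] [μ.IsOpenPosMeasure]

/-- Probability integral transform: increments of the distribution function under `μ` become
lengths, which turns the cross-multiplied increments below into slopes. -/
lemma measureReal_upperTail_le {u : ℝ} (hu : u ∈ Icc (0 : ℝ) 1) :
    μ.real {x | upperTail μ x ≤ u} = u := by
  rcases hu.1.eq_or_lt with rfl | h0
  · simp [(upperTail_pos μ _).not_ge]
  rcases hu.2.eq_or_lt with rfl | h1
  · simp [(upperTail_lt_one μ _).le]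
  obtain ⟨x, hx⟩ := exists_upperTail_eq μ ⟨h0, h1⟩
  have : {y | upperTail μ y ≤ u} = Ici x := by
    ext y
    rw [mem_ofPred_eq, ← hx, (strictAnti_upperTail μ).le_iff_ge, mem_Ici]
  rw [this, measureReal_congr (Ioi_ae_eq_Ici (μ := μ)).symm, ← hx, upperTail]

/-- Cross-multiplied comparison of the increments of the distribution functions of the upper tail
of `μ` under two measures that are ordered by the likelihood ratio order. -/
lemma LikelihoodRatioLE.increments_le {α β : Measure ℝ} [IsProbabilityMeasure α]
    [IsProbabilityMeasure β] (h : LikelihoodRatioLE α β) {x y z : ℝ} (hx : 0 ≤ x) (hxy : x < y)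
    (hyz : y < z) (hz : z ≤ 1) :
    (β.real {t | upperTail μ t ≤ z} - β.real {t | upperTail μ t ≤ y}) *
        (α.real {t | upperTail μ t ≤ y} - α.real {t | upperTail μ t ≤ x}) ≤
      (α.real {t | upperTail μ t ≤ z} - α.real {t | upperTail μ t ≤ y}) *
        (β.real {t | upperTail μ t ≤ y} - β.real {t | upperTail μ t ≤ x}) := by
  -- The tail function is decreasing, so the preimage of `(y, z]` lies to the left of its
  -- `y`-quantile `s` and that of `(x, y]` to the right.
  obtain ⟨s, hs⟩ := exists_upperTail_eq μ (u := y) ⟨hx.trans_lt hxy, hyz.trans_le hz⟩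
  simp only [← measureReal_upperTail_mem_Ioc μ _ hxy.le, ← measureReal_upperTail_mem_Ioc μ _ hyz.le]
  simp only [measureReal_def, ← ENNReal.toReal_mul]
  refine ENNReal.toReal_mono (ENNReal.mul_ne_top (measure_ne_top _ _) (measure_ne_top _ _)) ?_
  refine h s _ _ (measurable_upperTail μ measurableSet_Ioc)
    (measurable_upperTail μ measurableSet_Ioc) (fun t ht => ?_) (fun t ht => ?_)
  · exact ((strictAnti_upperTail μ).lt_iff_gt.1 (hs ▸ ht.1)).le
  · exact (strictAnti_upperTail μ).le_iff_ge.1 (hs ▸ ht.2)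

/-- Taking `α = μ` in the increment inequality makes the `α`-increments equal to `z - y` and `y -
x`: slopes over adjacent intervals decrease. -/
lemma concaveOn_measureReal_upperTail_le {ν : Measure ℝ} [IsProbabilityMeasure ν]
    (h : LikelihoodRatioLE μ ν) :
    ConcaveOn ℝ (Icc 0 1) fun u => ν.real {t | upperTail μ t ≤ u} := by
  refine concaveOn_of_slope_anti_adjacent (convex_Icc 0 1) fun {x y z} hx hz hxy hyz => ?_
  have h1 := h.increments_le μ hx.1 hxy hyz hz.2
  rw [measureReal_upperTail_le μ hx, measureReal_upperTail_le μ hz,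
    measureReal_upperTail_le μ ⟨hx.1.trans hxy.le, hyz.le.trans hz.2⟩] at h1
  rw [div_le_div_iff₀ (sub_pos.2 hyz) (sub_pos.2 hxy)]
  linarith

lemma convexOn_measureReal_upperTail_le {ν : Measure ℝ} [IsProbabilityMeasure ν]
    (h : LikelihoodRatioLE ν μ) :
    ConvexOn ℝ (Icc 0 1) fun u => ν.real {t | upperTail μ t ≤ u} := by
  refine convexOn_of_slope_mono_adjacent (convex_Icc 0 1) fun {x y z} hx hz hxy hyz => ?_
  have h1 := h.increments_le μ hx.1 hxy hyz hz.2
  rw [measureReal_upperTail_le μ hx, measureReal_upperTail_le μ hz,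
    measureReal_upperTail_le μ ⟨hx.1.trans hxy.le, hyz.le.trans hz.2⟩] at h1
  rw [div_le_div_iff₀ (sub_pos.2 hxy) (sub_pos.2 hyz)]
  linarith

/-- Rejection at level `a` is equivalent to the upper tail probability being less than `a`. -/
lemma mem_upperRegion_iff {a t : ℝ} (ha : a ∈ Ioo (0 : ℝ) 1) :
    t ∈ upperRegion μ a ↔ upperTail μ t < a := by
  obtain ⟨x, hx⟩ := exists_upperTail_eq μ ha
  -- The set defining the quantile is a closed half-line, so its infimum is the point where the tail
  -- equals `a`.
  have : {y : ℝ | 1 - a ≤ μ.real (Iic y)} = Ici x := by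
    ext y
    rw [mem_ofPred_eq, mem_Ici, ← (strictAnti_upperTail μ).le_iff_ge (a := y), hx,
      upperTail_eq_one_sub]
    constructor <;> intro <;> linarith
  rw [upperRegion, quantile, this, csInf_Ici, mem_Ioi, ← hx, (strictAnti_upperTail μ).lt_iff_gt]

lemma measureReal_upperRegion {a : ℝ} (ha : a ∈ Ioo (0 : ℝ) 1) : μ.real (upperRegion μ a) = a := by
  obtain ⟨x, hx⟩ := exists_upperTail_eq μ ha
  have : upperRegion μ a = Ioi x := by
    ext t
    rw [mem_upperRegion_iff μ ha, ← hx, (strictAnti_upperTail μ).lt_iff_gt, mem_Ioi]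
  rw [this, ← hx, upperTail]

/-- The LFC-based `p`-value is the upper tail probability of the test statistic, if the null
distributions are stochastically dominated by a least favorable one. -/
lemma pLFC_upperRegion {Θ Ω : Type*} [MeasurableSpace Ω] (P : Θ → Measure Ω) (null : Set Θ)
    (T : Ω → ℝ) (hT : Measurable T)
    (hle : ∀ ϑ ∈ null, ∀ q, (P ϑ).map T (Ioi q) ≤ μ (Ioi q))
    (hex : ∃ ϑ ∈ null, (P ϑ).map T = μ) (ω : Ω) :
    pLFC P null T (upperRegion μ) ω = upperTail μ (T ω) := by
  have hsup : ∀ a ∈ Ioo (0 : ℝ) 1,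
      sSup ((fun ϑ => (P ϑ).real {ω' | T ω' ∈ upperRegion μ a}) '' null) = a := by
    intro a ha
    have hmeas : ∀ ϑ, (P ϑ).real {ω' | T ω' ∈ upperRegion μ a} =
        ((P ϑ).map T).real (upperRegion μ a) := fun ϑ =>
      (map_measureReal_apply hT measurableSet_Ioi).symm
    refine IsGreatest.csSup_eq ⟨?_, ?_⟩
    · obtain ⟨ϑ, hϑ, h⟩ := hex
      exact ⟨ϑ, hϑ, by simp only [hmeas, h, measureReal_upperRegion μ ha]⟩
    · rintro _ ⟨ϑ, hϑ, rfl⟩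
      simp only [hmeas]
      calc _ ≤ μ.real (upperRegion μ a) :=
            ENNReal.toReal_mono (measure_ne_top _ _) (hle ϑ hϑ _)
        _ = a := measureReal_upperRegion μ ha
  -- The rejecting levels form an interval, nonempty because the tail is below `1`; its infimum is
  -- the tail.
  have hset : {a : ℝ | a ∈ Ioo (0 : ℝ) 1 ∧ T ω ∈ upperRegion μ a} = Ioo (upperTail μ (T ω)) 1 := by
    ext a
    simp only [mem_ofPred_eq]
    constructor
    · rintro ⟨ha, h⟩
      exact ⟨(mem_upperRegion_iff μ ha).1 h, ha.2⟩
    · rintro ⟨h, h1⟩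
      have ha : a ∈ Ioo (0 : ℝ) 1 := ⟨(upperTail_pos μ _).trans h, h1⟩
      exact ⟨ha, (mem_upperRegion_iff μ ha).2 h⟩
  rw [pLFC, hset, image_congr (g := id), image_id, csInf_Ioo (upperTail_lt_one μ _)]
  intro a ha
  exact hsup a ⟨(upperTail_pos μ _).trans ha.1, ha.2⟩

end UpperTail

/-! ### Randomized `p`-values -/

/-- Concavity along the segment from `0` to `c`. This is the comparison with the purely random `U`.
-/
lemma ConcaveOn.mul_le_of_zero {H : ℝ → ℝ} (hH : ConcaveOn ℝ (Icc 0 1) H) (h0 : H 0 = 0)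
    {t c : ℝ} (ht : t ∈ Icc (0 : ℝ) 1) (hc : c ∈ Icc (0 : ℝ) 1) : t * H c ≤ H (t * c) := by
  have h := hH.2 (x := 0) (y := c) (by simp) hc (sub_nonneg.2 ht.2) ht.1 (by ring)
  simpa [h0] using h

/-- Both `t` and `c` lie in `[tc, 1]`, where `H` is above its chord. Adding the chord bounds at `t`
and `c` with weights `1` and `t` gives total coefficients `1 - tc` for `H(tc)` and `t(1 - tc)` for
`H(1)`. This is the comparison with the LFC-based p-value. -/
lemma ConcaveOn.map_mul_add_mul_le {H : ℝ → ℝ} (hH : ConcaveOn ℝ (Icc 0 1) H)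
    {t c : ℝ} (ht : t ∈ Ico (0 : ℝ) 1) (hc : c ∈ Icc (0 : ℝ) 1) :
    H (t * c) + t * H 1 ≤ H t + t * H c := by
  obtain ⟨ht0, ht1⟩ := ht
  obtain ⟨hc0, hc1⟩ := hc
  have hd : t * c < 1 := by nlinarith
  have key : ∀ y, t * c ≤ y → y ≤ 1 →
      (1 - y) * H (t * c) + (y - t * c) * H 1 ≤ (1 - t * c) * H y := by
    intro y hy hy1
    have hd' : 0 < 1 - t * c := by linarith
    have h := hH.2 (x := t * c) (y := 1) ⟨by positivity, hd.le⟩ (by simp)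
      (div_nonneg (sub_nonneg.2 hy1) hd'.le) (div_nonneg (sub_nonneg.2 hy) hd'.le)
      (by field_simp; ring)
    have hy' : ((1 - y) / (1 - t * c)) • (t * c) + ((y - t * c) / (1 - t * c)) • (1 : ℝ) = y := by
      simp only [smul_eq_mul]; field_simp; ring
    rw [hy'] at h
    simp only [smul_eq_mul] at h
    calc _ = (1 - t * c) * ((1 - y) / (1 - t * c) * H (t * c) +
          (y - t * c) / (1 - t * c) * H 1) := by field_simp
      _ ≤ _ := by gcongr
  have h1 := key t (mul_le_of_le_one_right ht0 hc1) ht1.le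
  have h2 := mul_le_mul_of_nonneg_left (key c (mul_le_of_le_one_left hc0 ht1.le) hc1) ht0
  have h3 : (1 - t * c) * (H (t * c) + t * H 1) ≤ (1 - t * c) * (H t + t * H c) := by linarith
  exact le_of_mul_le_mul_left h3 (by linarith)

lemma measureReal_lt_of_map_eq_uniform {Ω : Type*} [MeasurableSpace Ω] {P : Measure Ω}
    {U : Ω → ℝ} (hU : Measurable U) (hunif : P.map U = volume.restrict (Icc (0 : ℝ) 1))
    {t : ℝ} (ht : t ∈ Icc (0 : ℝ) 1) : P.real {ω | t < U ω} = 1 - t := by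
  have h : P.real {ω | t < U ω} = (P.map U).real (Ioi t) :=
    (map_measureReal_apply hU measurableSet_Ioi).symm
  have h2 : Ioi t ∩ Icc 0 1 = Ioc t 1 := by
    ext x
    simp only [mem_inter_iff, mem_Ioi, mem_Icc, mem_Ioc]
    exact ⟨fun h => ⟨h.1, h.2.2⟩, fun h => ⟨h.1, ht.1.trans h.1.le, h.2⟩⟩
  rw [h, hunif, measureReal_restrict_apply measurableSet_Ioi, h2, Real.volume_real_Ioc_of_le ht.2]

lemma ae_mem_Icc_of_map_eq_uniform {Ω : Type*} [MeasurableSpace Ω] {P : Measure Ω}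
    {U : Ω → ℝ} (hU : Measurable U)
    (hunif : P.map U = volume.restrict (Icc (0 : ℝ) 1)) : ∀ᵐ ω ∂P, U ω ∈ Icc (0 : ℝ) 1 := by
  refine ae_of_ae_map hU.aemeasurable (p := fun u => u ∈ Icc (0 : ℝ) 1) ?_
  rw [hunif]
  exact ae_restrict_mem measurableSet_Icc

section Randomize

variable {Ω : Type*} [MeasurableSpace Ω] {P : Measure Ω} [IsProbabilityMeasure P] {V U : Ω → ℝ}

/-- Survival function of the randomized `p`-value. -/
lemma measureReal_lt_pRand (hV : Measurable V) (hU : Measurable U) (hind : IndepFun V U P)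
    (hunif : P.map U = volume.restrict (Icc (0 : ℝ) 1)) (hV0 : ∀ ω, 0 < V ω)
    {c t : ℝ} (hc : c ∈ Icc (0 : ℝ) 1) (hVc : P {ω | V ω = c} = 0) (ht : t ∈ Ico (0 : ℝ) 1) :
    P.real {ω | t < pRand (V ω) (U ω) c} =
      (1 - t) * (1 - P.real {ω | V ω ≤ c}) +
        (P.real {ω | V ω ≤ c} - P.real {ω | V ω ≤ t * c}) := by
  have hle : ∀ u, MeasurableSet {ω | V ω ≤ u} := fun u => measurableSet_le hV measurable_const
  have hset : {ω | t < pRand (V ω) (U ω) c} =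
      ({ω | c ≤ V ω} ∩ {ω | t < U ω}) ∪ ({ω | V ω < c} \ {ω | V ω ≤ t * c}) := by
    ext ω
    simp only [mem_ofPred_eq, mem_union, mem_inter_iff, mem_sdiff, pRand, not_le]
    rcases hc.1.eq_or_lt with rfl | hc0
    -- For `c = 0`, positivity of `V` puts every `ω` in `{c ≤ V}`, so the convention for `pRand`
    -- agrees with the general formula.
    · simp [(hV0 ω).le, (hV0 ω).not_gt]
    rw [if_neg hc0.ne']
    split_ifs with h
    · simp [h, h.not_gt]
    · simp [h, not_le.1 h, ← div_eq_mul_inv, lt_div_iff₀ hc0]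
  have hdisj : Disjoint ({ω | c ≤ V ω} ∩ {ω | t < U ω})
      ({ω | V ω < c} \ {ω | V ω ≤ t * c}) :=
    Set.disjoint_left.2 fun ω (h1 : c ≤ V ω ∧ t < U ω) (h2 : V ω < c ∧ _) => h2.1.not_ge h1.1
  have hprod : P.real ({ω | c ≤ V ω} ∩ {ω | t < U ω}) =
      P.real {ω | c ≤ V ω} * P.real {ω | t < U ω} := by
    simp only [measureReal_def, ← ENNReal.toReal_mul]
    congr 1
    exact hind.measure_inter_preimage_eq_mul (Ici c) (Ioi t) measurableSet_Ici measurableSet_Ioi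
  have hlt : P.real {ω | V ω < c} = P.real {ω | V ω ≤ c} := by
    refine measureReal_congr ?_
    have h0 : ∀ᵐ ω ∂P, V ω ≠ c := by simpa [ae_iff] using hVc
    filter_upwards [h0] with ω hω
    exact propext ⟨fun h : V ω < c => h.le, fun h : V ω ≤ c => lt_of_le_of_ne h hω⟩
  have hge : P.real {ω | c ≤ V ω} = 1 - P.real {ω | V ω ≤ c} := by
    rw [← hlt, ← probReal_compl_eq_one_sub (measurableSet_lt hV measurable_const)]
    congr 1
    ext ω
    simp
  -- Only almost sure: for `c = 0` the bound `t * c` is `c` itself, so the value `c` must be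
  -- excluded.
  have hsub : {ω | V ω ≤ t * c} ≤ᵐ[P] {ω | V ω < c} := by
    have h0 : ∀ᵐ ω ∂P, V ω ≠ c := by simpa [ae_iff] using hVc
    filter_upwards [h0] with ω hω
    exact fun h : V ω ≤ t * c =>
      lt_of_le_of_ne (h.trans (mul_le_of_le_one_left hc.1 ht.2.le)) hω
  have hdiff : P.real ({ω | V ω < c} \ {ω | V ω ≤ t * c}) =
      P.real {ω | V ω ≤ c} - P.real {ω | V ω ≤ t * c} := by
    rw [measureReal_sdiff' (hle _) (measure_ne_top _ _) (measure_ne_top _ _), ← hlt]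
    congr 1
    refine measureReal_congr ?_
    filter_upwards [hsub] with ω hω
    exact propext ⟨fun h => h.elim id hω, Or.inl⟩
  rw [hset, measureReal_union hdisj ((measurableSet_lt hV measurable_const).diff (hle _)), hprod,
    hge, hdiff, measureReal_lt_of_map_eq_uniform hU hunif ⟨ht.1, ht.2.le⟩]
  ring

/-- Two random variables with values in `[0, 1]` are stochastically ordered as soon as their
survival functions are ordered on `[0, 1)`. -/
lemma stochLE_of_unit_interval {A B : Ω → ℝ} (hA : ∀ᵐ ω ∂P, A ω ≤ 1) (hB : ∀ᵐ ω ∂P, 0 ≤ B ω)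
    (h : ∀ t ∈ Ico (0 : ℝ) 1, P.real {ω | t < A ω} ≤ P.real {ω | t < B ω}) : StochLE P A B := by
  intro t
  rcases lt_or_ge t 0 with ht | ht
  · have : P {ω | t < B ω} = 1 := by
      rw [← measure_univ (μ := P)]
      refine measure_congr ?_
      filter_upwards [hB] with ω hω
      exact propext ⟨fun _ => trivial, fun _ => ht.trans_le hω⟩
    rw [this]
    exact prob_le_one
  rcases lt_or_ge t 1 with ht1 | ht1
  · exact (ENNReal.toReal_le_toReal (measure_ne_top _ _) (measure_ne_top _ _)).1 (h t ⟨ht, ht1⟩)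
  · have : P {ω | t < A ω} = 0 := by
      have h0 : ∀ᵐ ω ∂P, ¬ t < A ω := by
        filter_upwards [hA] with ω hω
        exact not_lt.2 (hω.trans ht1)
      simpa [ae_iff] using h0
    rw [this]
    exact zero_le

lemma pRand_mem_Icc {p u c : ℝ} (hp : p ∈ Icc (0 : ℝ) 1) (hu : u ∈ Icc (0 : ℝ) 1)
    (hc : c ∈ Icc (0 : ℝ) 1) : pRand p u c ∈ Icc (0 : ℝ) 1 := by
  unfold pRand
  split_ifs with h1 h2
  · exact hu
  · exact hu
  · have hc0 : 0 < c := lt_of_le_of_ne hc.1 (Ne.symm h1)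
    rw [← div_eq_mul_inv]
    exact ⟨div_nonneg hp.1 hc.1, (div_le_one hc0).2 (not_le.1 h2).le⟩

lemma measureReal_lt_eq_one_sub (hV : Measurable V) (t : ℝ) :
    P.real {ω | t < V ω} = 1 - P.real {ω | V ω ≤ t} := by
  rw [← probReal_compl_eq_one_sub (measurableSet_le hV measurable_const)]
  congr 1
  ext ω
  simp

/-- With `H` the distribution function of `V`, the survival function of the randomized p-value
rearranges to `1 - t + t H(c) - H(tc)`; each claim is then one of the two concavity inequalities. -/
lemma stochLE_pRand_of_concaveOn (hV : Measurable V) (hU : Measurable U) (hind : IndepFun V U P)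
    (hunif : P.map U = volume.restrict (Icc (0 : ℝ) 1)) (hV01 : ∀ ω, V ω ∈ Ioo (0 : ℝ) 1)
    {c : ℝ} (hc : c ∈ Icc (0 : ℝ) 1) (hVc : P {ω | V ω = c} = 0)
    (hH : ConcaveOn ℝ (Icc 0 1) fun u => P.real {ω | V ω ≤ u}) :
    StochLE P V (fun ω => pRand (V ω) (U ω) c) ∧
      StochLE P (fun ω => pRand (V ω) (U ω) c) U := by
  have hUI := ae_mem_Icc_of_map_eq_uniform hU hunif
  have hR : ∀ᵐ ω ∂P, pRand (V ω) (U ω) c ∈ Icc (0 : ℝ) 1 := by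
    filter_upwards [hUI] with ω hω
    exact pRand_mem_Icc (Ioo_subset_Icc_self (hV01 ω)) hω hc
  have h0 : P.real {ω | V ω ≤ 0} = 0 := by simp [(hV01 _).1.not_ge]
  have h1 : P.real {ω | V ω ≤ 1} = 1 := by simp [(hV01 _).2.le]
  constructor
  · refine stochLE_of_unit_interval (.of_forall fun ω => (hV01 ω).2.le)
      (hR.mono fun ω h => h.1) fun t ht => ?_
    rw [measureReal_lt_pRand hV hU hind hunif (fun ω => (hV01 ω).1) hc hVc ht,
      measureReal_lt_eq_one_sub hV]
    have := hH.map_mul_add_mul_le ht hc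
    simp only [h1] at this
    linarith
  · refine stochLE_of_unit_interval (hR.mono fun ω h => h.2) (hUI.mono fun ω h => h.1)
      fun t ht => ?_
    rw [measureReal_lt_pRand hV hU hind hunif (fun ω => (hV01 ω).1) hc hVc ht,
      measureReal_lt_of_map_eq_uniform hU hunif (Ico_subset_Icc_self ht)]
    have := hH.mul_le_of_zero h0 (Ico_subset_Icc_self ht) hc
    linarith

lemma stochLE_pRand_of_convexOn (hV : Measurable V) (hU : Measurable U) (hind : IndepFun V U P)
    (hunif : P.map U = volume.restrict (Icc (0 : ℝ) 1)) (hV01 : ∀ ω, V ω ∈ Ioo (0 : ℝ) 1)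
    {c : ℝ} (hc : c ∈ Icc (0 : ℝ) 1) (hVc : P {ω | V ω = c} = 0)
    (hH : ConvexOn ℝ (Icc 0 1) fun u => P.real {ω | V ω ≤ u}) :
    StochLE P U (fun ω => pRand (V ω) (U ω) c) ∧
      StochLE P (fun ω => pRand (V ω) (U ω) c) V := by
  have hUI := ae_mem_Icc_of_map_eq_uniform hU hunif
  have hR : ∀ᵐ ω ∂P, pRand (V ω) (U ω) c ∈ Icc (0 : ℝ) 1 := by
    filter_upwards [hUI] with ω hω
    exact pRand_mem_Icc (Ioo_subset_Icc_self (hV01 ω)) hω hc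
  have h0 : P.real {ω | V ω ≤ 0} = 0 := by simp [(hV01 _).1.not_ge]
  have h1 : P.real {ω | V ω ≤ 1} = 1 := by simp [(hV01 _).2.le]
  constructor
  · refine stochLE_of_unit_interval (hUI.mono fun ω h => h.2) (hR.mono fun ω h => h.1)
      fun t ht => ?_
    rw [measureReal_lt_pRand hV hU hind hunif (fun ω => (hV01 ω).1) hc hVc ht,
      measureReal_lt_of_map_eq_uniform hU hunif (Ico_subset_Icc_self ht)]
    -- The concavity inequalities apply to `-H`, which reverses both orderings.
    have := hH.neg.mul_le_of_zero (by simp [h0]) (Ico_subset_Icc_self ht) hc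
    simp only [Pi.neg_apply] at this
    linarith
  · refine stochLE_of_unit_interval (hR.mono fun ω h => h.2)
      (.of_forall fun ω => (hV01 ω).1.le) fun t ht => ?_
    rw [measureReal_lt_pRand hV hU hind hunif (fun ω => (hV01 ω).1) hc hVc ht,
      measureReal_lt_eq_one_sub hV]
    have := hH.neg.map_mul_add_mul_le ht hc
    simp only [Pi.neg_apply, h1] at this
    linarith

end Randomize

/-- Ordering of the LFC-based, the randomized, and the purely random `p`-value for a test statistic
whose distribution is comparable to the least favorable one in the likelihood ratio order. -/
theorem stochLE_pRand_upperTail {Ω : Type*} [MeasurableSpace Ω] {P : Measure Ω}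
    [IsProbabilityMeasure P] {T U : Ω → ℝ} (μ : Measure ℝ) [IsProbabilityMeasure μ]
    [NullSingletonClass μ] [μ.IsOpenPosMeasure] (hT : Measurable T) (hU : Measurable U)
    (hind : IndepFun T U P) (hunif : P.map U = volume.restrict (Icc (0 : ℝ) 1))
    (hac : P.map T ≪ μ) {c : ℝ} (hc : c ∈ Icc (0 : ℝ) 1) :
    (LikelihoodRatioLE (P.map T) μ →
      StochLE P U (fun ω => pRand (upperTail μ (T ω)) (U ω) c) ∧
      StochLE P (fun ω => pRand (upperTail μ (T ω)) (U ω) c) (fun ω => upperTail μ (T ω))) ∧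
    (LikelihoodRatioLE μ (P.map T) →
      StochLE P (fun ω => upperTail μ (T ω)) (fun ω => pRand (upperTail μ (T ω)) (U ω) c) ∧
      StochLE P (fun ω => pRand (upperTail μ (T ω)) (U ω) c) U) := by
  have hprob : IsProbabilityMeasure (P.map T) := Measure.isProbabilityMeasure_map hT.aemeasurable
  have hV : Measurable fun ω => upperTail μ (T ω) := (measurable_upperTail μ).comp hT
  have hVU : IndepFun (fun ω => upperTail μ (T ω)) U P :=
    hind.comp (measurable_upperTail μ) measurable_id
  have hV01 : ∀ ω, upperTail μ (T ω) ∈ Ioo (0 : ℝ) 1 := fun ω =>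
    ⟨upperTail_pos μ _, upperTail_lt_one μ _⟩
  -- The strictly decreasing tail takes the value `c` at most once, and the law of `T` inherits the
  -- absence of atoms from `μ`.
  have hVc : P {ω | upperTail μ (T ω) = c} = 0 := by
    have h0 : μ {x | upperTail μ x = c} = 0 :=
      Set.Subsingleton.measure_zero
        (fun x (hx : _ = _) y (hy : _ = _) => (strictAnti_upperTail μ).injective (hx.trans hy.symm)) μ
    have h1 := hac h0
    rwa [Measure.map_apply hT (measurableSet_eq_fun (measurable_upperTail μ) measurable_const)] at h1
  have hH : (fun u => P.real {ω | upperTail μ (T ω) ≤ u}) =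
      fun u => (P.map T).real {t | upperTail μ t ≤ u} := by
    ext u
    rw [map_measureReal_apply hT (measurableSet_le (measurable_upperTail μ) measurable_const)]
    rfl
  refine ⟨fun h => ?_, fun h => ?_⟩
  · exact stochLE_pRand_of_convexOn hV hU hVU hunif hV01 hc hVc
      (hH ▸ convexOn_measureReal_upperTail_le μ h)
  · exact stochLE_pRand_of_concaveOn hV hU hVU hunif hV01 hc hVc
      (hH ▸ concaveOn_measureReal_upperTail_le μ h)

/-- Ordering of the LFC-based, the randomized, and the purely random `p`-value in a statistical
model whose test statistic has distributions comparable to a least favorable one. -/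
theorem stochLE_pRand_pLFC {Θ Ω : Type*} [MeasurableSpace Ω] (P : Θ → Measure Ω)
    [∀ ϑ, IsProbabilityMeasure (P ϑ)] (null : Set Θ) {T U : Ω → ℝ} (μ : Measure ℝ)
    [IsProbabilityMeasure μ] [NullSingletonClass μ] [μ.IsOpenPosMeasure] (hT : Measurable T)
    (hU : Measurable U) (hind : ∀ ϑ, IndepFun T U (P ϑ))
    (hunif : ∀ ϑ, (P ϑ).map U = volume.restrict (Icc (0 : ℝ) 1))
    (hac : ∀ ϑ, (P ϑ).map T ≪ μ)
    (hnull : ∀ ϑ ∈ null, LikelihoodRatioLE ((P ϑ).map T) μ)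
    (halt : ∀ ϑ ∉ null, LikelihoodRatioLE μ ((P ϑ).map T))
    (hex : Nonempty Θ → ∃ ϑ ∈ null, (P ϑ).map T = μ) {c : ℝ} (hc : c ∈ Icc (0 : ℝ) 1) :
    (∀ ϑ ∈ null,
      StochLE (P ϑ) U (fun ω => pRand (pLFC P null T (upperRegion μ) ω) (U ω) c) ∧
      StochLE (P ϑ) (fun ω => pRand (pLFC P null T (upperRegion μ) ω) (U ω) c)
        (pLFC P null T (upperRegion μ))) ∧
    (∀ ϑ ∉ null,
      StochLE (P ϑ) (pLFC P null T (upperRegion μ))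
        (fun ω => pRand (pLFC P null T (upperRegion μ) ω) (U ω) c) ∧
      StochLE (P ϑ) (fun ω => pRand (pLFC P null T (upperRegion μ) ω) (U ω) c) U) := by
  have hp : Nonempty Θ → pLFC P null T (upperRegion μ) = fun ω => upperTail μ (T ω) := by
    intro hΘ
    ext ω
    refine pLFC_upperRegion μ P null T hT (fun ϑ hϑ q => ?_) (hex hΘ) ω
    have hprob : IsProbabilityMeasure ((P ϑ).map T) :=
      Measure.isProbabilityMeasure_map hT.aemeasurable
    exact (hnull ϑ hϑ).measure_Ioi_le q
  refine ⟨fun ϑ hϑ => ?_, fun ϑ hϑ => ?_⟩ <;> rw [hp ⟨ϑ⟩]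
  · exact (stochLE_pRand_upperTail μ hT hU (hind ϑ) (hunif ϑ) (hac ϑ) hc).1 (hnull ϑ hϑ)
  · exact (stochLE_pRand_upperTail μ hT hU (hind ϑ) (hunif ϑ) (hac ϑ) hc).2 (halt ϑ hϑ)

/-! ### Gaussian shifts and the multiple `Z`-tests model -/

lemma isOpenPosMeasure_gaussianReal (d : ℝ) {v : ℝ≥0} (hv : v ≠ 0) :
    (gaussianReal d v).IsOpenPosMeasure :=
  (gaussianReal_absolutelyContinuous' d hv).isOpenPosMeasure

/-- Exponential tilting of a centered normal distribution shifts its mean. -/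
lemma gaussianReal_eq_withDensity (d : ℝ) {v : ℝ≥0} (hv : v ≠ 0) :
    gaussianReal d v = (gaussianReal 0 v).withDensity
      fun x => ENNReal.ofReal (Real.exp ((d * x - d ^ 2 / 2) / v)) := by
  rw [gaussianReal_of_var_ne_zero d hv, gaussianReal_of_var_ne_zero 0 hv,
    ← withDensity_mul _ (measurable_gaussianPDF 0 v) (by fun_prop)]
  congr 1
  ext x
  rw [Pi.mul_apply, gaussianPDF, gaussianPDF, ← ENNReal.ofReal_mul (gaussianPDFReal_nonneg _ _ _)]
  have hv' : (v : ℝ) ≠ 0 := by exact_mod_cast hv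
  rw [gaussianPDFReal, gaussianPDFReal, mul_assoc (√(2 * Real.pi * v))⁻¹ (Real.exp _), ← Real.exp_add]
  congr 3
  field_simp
  ring

lemma likelihoodRatioLE_gaussianReal_of_nonneg {d : ℝ} (hd : 0 ≤ d) {v : ℝ≥0} (hv : v ≠ 0) :
    LikelihoodRatioLE (gaussianReal 0 v) (gaussianReal d v) := by
  rw [gaussianReal_eq_withDensity d hv]
  refine likelihoodRatioLE_withDensity_of_monotone _ fun x y h => ?_
  gcongr

lemma likelihoodRatioLE_gaussianReal_of_nonpos {d : ℝ} (hd : d ≤ 0) {v : ℝ≥0} (hv : v ≠ 0) :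
    LikelihoodRatioLE (gaussianReal d v) (gaussianReal 0 v) := by
  rw [gaussianReal_eq_withDensity d hv]
  refine likelihoodRatioLE_withDensity_of_antitone _ fun x y h => ?_
  have := mul_le_mul_of_nonpos_left h hd
  gcongr ENNReal.ofReal (Real.exp ((?_ - _) / _))

lemma map_sum_eq_gaussianReal {Ω ι : Type*} [MeasurableSpace Ω] {P : Measure Ω}
    [IsProbabilityMeasure P] {X : ι → Ω → ℝ} (hX : ∀ i, Measurable (X i)) (hind : iIndepFun X P)
    {d : ℝ} {v : ℝ≥0} (hlaw : ∀ i, P.map (X i) = gaussianReal d v) (s : Finset ι) :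
    P.map (∑ i ∈ s, X i) = gaussianReal (s.card * d) (s.card * v) := by
  classical
  induction s using Finset.induction_on with
  | empty =>
    have : (0 : Ω → ℝ) = fun _ => 0 := rfl
    simp [this, Measure.map_const, gaussianReal_zero_var]
  | insert i s hi ih =>
    rw [Finset.sum_insert hi, Finset.card_insert_of_notMem hi,
      gaussianReal_add_gaussianReal_of_indepFun
        (hind.indepFun_finsetSum_of_notMem hX hi).symm (hlaw i) ih]
    congr 1 <;> push_cast <;> ring

lemma measurable_sampleMean {Ω : Type*} [MeasurableSpace Ω] {k : ℕ} {X : Fin k → Ω → ℝ}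
    (hX : ∀ i, Measurable (X i)) : Measurable (sampleMean X) := by
  unfold sampleMean
  fun_prop

lemma map_sampleMean_eq_gaussianReal {Ω : Type*} [MeasurableSpace Ω] {P : Measure Ω}
    [IsProbabilityMeasure P] {k : ℕ} (hk : k ≠ 0) {X : Fin k → Ω → ℝ}
    (hX : ∀ i, Measurable (X i)) (hind : iIndepFun X P) {d : ℝ}
    (hlaw : ∀ i, P.map (X i) = gaussianReal d 1) :
    P.map (sampleMean X) = gaussianReal d (k : ℝ≥0)⁻¹ := by
  have h : sampleMean X = (fun x => (k : ℝ)⁻¹ * x) ∘ (∑ i, X i) := by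
    ext ω
    simp [sampleMean]
  have hk' : (k : ℝ) ≠ 0 := by exact_mod_cast hk
  rw [h, ← Measure.map_map (by fun_prop) (by fun_prop : Measurable (∑ i, X i)),
    map_sum_eq_gaussianReal hX hind hlaw, gaussianReal_map_const_mul]
  simp only [Finset.card_univ, Fintype.card_fin, mul_one]
  congr 1
  · field_simp
  · ext
    push_cast
    field_simp

theorem stochLE_pRand_zPLFC {Ω N : Type*} [MeasurableSpace Ω] {m : ℕ} {n : Fin m → ℕ}
    {P : (Fin m → ℝ) × N → Measure Ω} {X : (j : Fin m) → Fin (n j) → Ω → ℝ}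
    {U : Fin m → Ω → ℝ} (hX : IsZTestsModel n P X)
    (hU : ∀ ϑ, IsRandomizer (P ϑ) (fun ω j i => X j i ω) U) (j : Fin m) {c : ℝ}
    (hc : c ∈ Icc (0 : ℝ) 1) :
    (∀ ϑ : (Fin m → ℝ) × N, ϑ.1 j ∈ Iic (0 : ℝ) →
      StochLE (P ϑ) (U j) (fun ω => pRand (zPLFC n P X j ω) (U j ω) c) ∧
      StochLE (P ϑ) (fun ω => pRand (zPLFC n P X j ω) (U j ω) c) (zPLFC n P X j)) ∧
    (∀ ϑ : (Fin m → ℝ) × N, ϑ.1 j ∈ Ioi (0 : ℝ) →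
      StochLE (P ϑ) (zPLFC n P X j) (fun ω => pRand (zPLFC n P X j ω) (U j ω) c) ∧
      StochLE (P ϑ) (fun ω => pRand (zPLFC n P X j ω) (U j ω) c) (U j)) := by
  rcases isEmpty_or_nonempty N with hN | hN
  · exact ⟨fun ϑ => isEmptyElim ϑ.2, fun ϑ => isEmptyElim ϑ.2⟩
  have hprob := hX.isProb
  have hn : n j ≠ 0 := Nat.one_le_iff_ne_zero.1 (hX.size_pos j)
  have hv : (n j : ℝ≥0)⁻¹ ≠ 0 := inv_ne_zero (by exact_mod_cast hn)
  have hopen := isOpenPosMeasure_gaussianReal 0 hv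
  have hsing := nullSingletonClass_gaussianReal (μ := 0) hv
  have hlaw : ∀ ϑ, (P ϑ).map (sampleMean (X j)) = gaussianReal (ϑ.1 j) (n j : ℝ≥0)⁻¹ := fun ϑ =>
    map_sampleMean_eq_gaussianReal hn (hX.measurable j) (hX.iIndep ϑ j) (hX.law ϑ j)
  obtain ⟨η⟩ := hN
  -- Writing the statistic as a measurable function of the whole data transfers the independence of
  -- data and randomizers to `T` and `U j`.
  have hstat : Measurable fun x : (j : Fin m) → Fin (n j) → ℝ =>
      (n j : ℝ)⁻¹ * ∑ i, x j i := by fun_prop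
  have key := stochLE_pRand_pLFC P {ϑ | ϑ.1 j ∈ Iic (0 : ℝ)}
    (gaussianReal 0 (n j : ℝ≥0)⁻¹) (measurable_sampleMean (hX.measurable j))
    ((hU (0, η)).measurable j)
    (fun ϑ => (hU ϑ).indep_data.comp hstat (measurable_pi_apply j))
    (fun ϑ => (hU ϑ).uniform j)
    (fun ϑ => by
      rw [hlaw, gaussianReal_eq_withDensity _ hv]
      exact withDensity_absolutelyContinuous _ _)
    (fun ϑ hϑ => by
      rw [hlaw]
      exact likelihoodRatioLE_gaussianReal_of_nonpos hϑ hv)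
    (fun ϑ hϑ => by
      rw [hlaw]
      exact likelihoodRatioLE_gaussianReal_of_nonneg (not_le.1 hϑ).le hv)
    (fun _ => ⟨(0, η), le_refl (0 : ℝ), hlaw _⟩) hc
  exact ⟨key.1, fun ϑ (hϑ : 0 < ϑ.1 j) => key.2 ϑ fun h => hϑ.not_ge h⟩

/-! ### Independence of norm and direction -/

section Polar

variable {E : Type*} [NormedAddCommGroup E] [NormedSpace ℝ E] [MeasurableSpace E] [BorelSpace E]
  [FiniteDimensional ℝ E] [Nontrivial E]

/-- Integration in polar coordinates of a product of a function of the norm and a function of the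
direction. -/
lemma lintegral_norm_mul_direction (μ : Measure E) [μ.IsAddHaarMeasure] {a : ℝ → ENNReal}
    (ha : Measurable a) {b : E → ENNReal} (hb : Measurable b)
    (hb_smul : ∀ (r : ℝ) (z : E), 0 < r → b (r • z) = b z) :
    ∫⁻ z, a ‖z‖ * b z ∂μ = (∫⁻ u, b (u : E) ∂μ.toSphere) *
      ∫⁻ r, a (r : ℝ) ∂Measure.volumeIoiPow (Module.finrank ℝ E - 1) := by
  have hemb := (homeomorphUnitSphereProd E).measurableEmbedding
  calc ∫⁻ z, a ‖z‖ * b z ∂μ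
      = ∫⁻ z : ({0}ᶜ : Set E), a ‖(z : E)‖ * b z ∂μ.comap (↑) := by
        rw [lintegral_subtype_comap (measurableSet_singleton _).compl fun z => a ‖z‖ * b z,
          restrict_compl_singleton]
    _ = ∫⁻ q, b (q.1 : E) * a (q.2 : ℝ)
          ∂μ.toSphere.prod (Measure.volumeIoiPow (Module.finrank ℝ E - 1)) := by
        rw [← μ.measurePreserving_homeomorphUnitSphereProd.lintegral_comp_emb hemb]
        refine lintegral_congr fun z => ?_
        have hz : (z : E) ≠ 0 := z.2
        rw [mul_comm, homeomorphUnitSphereProd_apply_snd_coe,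
          homeomorphUnitSphereProd_apply_fst_coe, hb_smul _ _ (by positivity)]
    _ = _ := lintegral_prod_mul (hb.comp measurable_subtype_coe).aemeasurable
        (ha.comp measurable_subtype_coe).aemeasurable

/-- Under a rotationally symmetric density, the norm is independent of every function of the
direction. -/
lemma indepFun_norm_of_withDensity (μ : Measure E) [μ.IsAddHaarMeasure] {f : ℝ → ENNReal}
    (hf : Measurable f) [IsProbabilityMeasure (μ.withDensity fun z => f ‖z‖)] {T : E → ℝ}
    (hT : Measurable T) (hT_smul : ∀ (r : ℝ) (z : E), 0 < r → T (r • z) = T z) :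
    IndepFun (fun z => ‖z‖) T (μ.withDensity fun z => f ‖z‖) := by
  -- The polar factorization splits the mass of every product event into a spherical and a radial
  -- factor. The total factors multiply to `1`, which converts this splitting into independence.
  have hone : (∫⁻ u, (1 : ENNReal) ∂μ.toSphere) *
      ∫⁻ r : Ioi (0 : ℝ), f r ∂Measure.volumeIoiPow (Module.finrank ℝ E - 1) = 1 := by
    rw [← lintegral_norm_mul_direction μ hf measurable_const fun _ _ _ => rfl]
    have h := measure_univ (μ := μ.withDensity fun z => f ‖z‖)
    rw [withDensity_apply _ MeasurableSet.univ, Measure.restrict_univ] at h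
    simpa using h
  have hprod : ∀ A B : Set ℝ, MeasurableSet A → MeasurableSet B →
      (μ.withDensity fun z => f ‖z‖) ((fun z => ‖z‖) ⁻¹' B ∩ T ⁻¹' A) =
        (∫⁻ u, A.indicator 1 (T (u : E)) ∂μ.toSphere) *
          ∫⁻ r : Ioi (0 : ℝ), f r * B.indicator 1 (r : ℝ)
            ∂Measure.volumeIoiPow (Module.finrank ℝ E - 1) := by
    intro A B hA hB
    have hmeas : MeasurableSet ((fun z : E => ‖z‖) ⁻¹' B ∩ T ⁻¹' A) :=
      (measurable_norm hB).inter (hT hA)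
    rw [withDensity_apply _ hmeas, ← lintegral_indicator hmeas]
    refine Eq.trans (lintegral_congr fun z => ?_)
      (lintegral_norm_mul_direction μ (hf.mul (measurable_one.indicator hB))
        ((measurable_one.indicator hA).comp hT)
        (fun r z hr => by simp only [Function.comp_apply, hT_smul r z hr]))
    by_cases h1 : ‖z‖ ∈ B <;> by_cases h2 : T z ∈ A <;> simp [indicator, h1, h2]
  rw [indepFun_iff_measure_inter_preimage_eq_mul]
  intro B A hB hA
  have hB' := hprod univ B MeasurableSet.univ hB
  have hA' := hprod A univ hA MeasurableSet.univ
  simp only [preimage_univ, inter_univ, univ_inter, indicator_univ, Pi.one_apply, mul_one]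
    at hA' hB'
  rw [hprod A B hA hB, hA', hB', mul_comm (∫⁻ _, (1 : ENNReal) ∂_), mul_mul_mul_comm, hone, mul_one,
    mul_comm]

end Polar

/-! ### Density of the standard Gaussian measure -/

lemma pi_gaussianReal_eq_withDensity (ι : Type*) [Fintype ι] :
    (Measure.pi fun _ : ι => gaussianReal 0 1) =
      volume.withDensity fun x : ι → ℝ => ENNReal.ofReal (∏ i, gaussianPDFReal 0 1 (x i)) := by
  refine (Measure.pi_eq fun s hs => ?_)
  have hint : ∀ i, Integrable (gaussianPDFReal 0 1) (volume.restrict (s i)) := fun i =>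
    (integrable_gaussianPDFReal 0 1).restrict
  rw [withDensity_apply _ (MeasurableSet.univ_pi hs), volume_pi, Measure.restrict_pi_pi,
    ← ofReal_integral_eq_lintegral_ofReal (Integrable.fintype_prod_dep hint)
      (.of_forall fun x => Finset.prod_nonneg fun i _ => gaussianPDFReal_nonneg _ _ _),
    integral_fintype_prod_eq_prod (fun _ => gaussianPDFReal 0 1),
    ENNReal.ofReal_prod_of_nonneg fun i _ =>
      integral_nonneg fun x => gaussianPDFReal_nonneg _ _ _]
  refine Finset.prod_congr rfl fun i _ => ?_
  rw [gaussianReal_apply_eq_integral 0 one_ne_zero]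

/-- The density of the standard Gaussian measure is a function of the norm. -/
lemma exists_stdGaussian_eq_withDensity_norm (ι : Type*) [Fintype ι] :
    ∃ f : ℝ → ENNReal, Measurable f ∧
      stdGaussian (EuclideanSpace ℝ ι) = volume.withDensity fun z => f ‖z‖ := by
  refine ⟨fun r => ENNReal.ofReal ((√(2 * Real.pi))⁻¹ ^ Fintype.card ι * Real.exp (-r ^ 2 / 2)),
    by fun_prop, ?_⟩
  have hvol := EuclideanSpace.volume_preserving_symm_measurableEquiv_toLp ι
  rw [← map_pi_eq_stdGaussian, pi_gaussianReal_eq_withDensity]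
  ext A hA
  rw [Measure.map_apply (by fun_prop) hA,
    withDensity_apply _ ((by fun_prop : Measurable (WithLp.toLp 2 : (ι → ℝ) → _)) hA),
    withDensity_apply _ hA, ← hvol.setLIntegral_comp_preimage_emb (MeasurableEquiv.measurableEmbedding _)]
  refine setLIntegral_congr_fun hA fun z _ => ?_
  simp [gaussianPDFReal, Finset.prod_mul_distrib, ← Real.exp_sum, EuclideanSpace.norm_sq_eq, Finset.sum_div, Finset.sum_neg_distrib, neg_div]

lemma indepFun_norm_stdGaussian (ι : Type*) [Fintype ι] [Nonempty ι]
    {T : EuclideanSpace ℝ ι → ℝ} (hT : Measurable T)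
    (hT_smul : ∀ (r : ℝ) (z : EuclideanSpace ℝ ι), 0 < r → T (r • z) = T z) :
    IndepFun (fun z => ‖z‖) T (stdGaussian (EuclideanSpace ℝ ι)) := by
  obtain ⟨f, hf, h⟩ := exists_stdGaussian_eq_withDensity_norm ι
  have : IsProbabilityMeasure (volume.withDensity fun z : EuclideanSpace ℝ ι => f ‖z‖) := by
    rw [← h]; infer_instance
  rw [h]
  exact indepFun_norm_of_withDensity volume hf hT hT_smul

/-! ### Student's `t`-distribution and its noncentral version -/

/-- The joint law of independent standard normal variables `Z`, `Y₁, …, Y_k`. -/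
def gaussianPair (k : ℕ) : Measure (ℝ × (Fin k → ℝ)) :=
  (gaussianReal 0 1).prod (Measure.pi fun _ => gaussianReal 0 1)

instance (k : ℕ) : IsProbabilityMeasure (gaussianPair k) := by
  unfold gaussianPair; infer_instance

/-- The quotient `Z / √(∑ Yᵢ² / k)`. -/
def studentRatio {k : ℕ} (q : ℝ × (Fin k → ℝ)) : ℝ := q.1 / √((∑ i, q.2 i ^ 2) / k)

@[fun_prop]
lemma measurable_studentRatio {k : ℕ} : Measurable (studentRatio (k := k)) := by
  unfold studentRatio; fun_prop

/-- The noncentral `t`-distribution with `k` degrees of freedom: the law of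
`(Z + d) / √(V / k)` with independent `Z ∼ N(0, 1)` and `V ∼ χ²_k`. -/
def noncentralTMeasure (k : ℕ) (d : ℝ) : Measure ℝ :=
  (gaussianPair k).map fun q => studentRatio (q.1 + d, q.2)

instance (k : ℕ) (d : ℝ) : IsProbabilityMeasure (noncentralTMeasure k d) :=
  Measure.isProbabilityMeasure_map (by fun_prop)

lemma studentTMeasure_eq_map_studentRatio (k : ℕ) :
    studentTMeasure k = (gaussianPair k).map studentRatio := by
  have hs : Measurable fun z : Fin k → ℝ => ∑ i, z i ^ 2 := by fun_prop
  have h : (gaussianReal 0 1).prod (chiSquareMeasure k) =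
      (gaussianPair k).map (Prod.map id fun z => ∑ i, z i ^ 2) := by
    rw [gaussianPair, chiSquareMeasure, ← Measure.map_prod_map _ _ measurable_id hs,
      Measure.map_id]
  rw [studentTMeasure, h, Measure.map_map (by fun_prop) (by fun_prop)]
  rfl

lemma studentTMeasure_eq_noncentralTMeasure (k : ℕ) :
    studentTMeasure k = noncentralTMeasure k 0 := by
  rw [studentTMeasure_eq_map_studentRatio, noncentralTMeasure]
  simp

instance (k : ℕ) : IsProbabilityMeasure (studentTMeasure k) := by
  rw [studentTMeasure_eq_noncentralTMeasure]; infer_instance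

/-- A single coordinate is almost surely nonzero. Hence the convention `x / 0 = 0` in `studentRatio`
affects only a null set. -/
lemma ae_sum_sq_pos_gaussianPair {k : ℕ} (hk : k ≠ 0) :
    ∀ᵐ q ∂gaussianPair k, 0 < ∑ i, q.2 i ^ 2 := by
  have hsing := nullSingletonClass_gaussianReal (μ := 0) one_ne_zero
  have h : ∀ᵐ y ∂(Measure.pi fun _ : Fin k => gaussianReal 0 1), 0 < ∑ i, y i ^ 2 := by
    have h0 : ∀ᵐ y ∂(Measure.pi fun _ : Fin k => gaussianReal 0 1),
        y ⟨0, Nat.pos_of_ne_zero hk⟩ ≠ 0 := by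
      rw [ae_iff]
      simpa using Measure.pi_hyperplane (fun _ : Fin k => gaussianReal 0 1)
        ⟨0, Nat.pos_of_ne_zero hk⟩ 0
    filter_upwards [h0] with y hy
    exact Finset.sum_pos' (fun i _ => sq_nonneg _) ⟨_, Finset.mem_univ _, by positivity⟩
  exact Measure.quasiMeasurePreserving_snd.ae h

lemma nullSingletonClass_studentTMeasure {k : ℕ} (hk : k ≠ 0) :
    NullSingletonClass (studentTMeasure k) := by
  have hsing := nullSingletonClass_gaussianReal (μ := 0) one_ne_zero
  refine ⟨fun x => ?_⟩
  rw [studentTMeasure_eq_map_studentRatio,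
    Measure.map_apply measurable_studentRatio (measurableSet_singleton x)]
  -- Fubini: for fixed denominator coordinates the section in the numerator is a single point.
  have h0 : gaussianPair k {q | q.1 = x * √((∑ i, q.2 i ^ 2) / k)} = 0 := by
    have hm : MeasurableSet {q : ℝ × (Fin k → ℝ) | q.1 = x * √((∑ i, q.2 i ^ 2) / k)} :=
      measurableSet_eq_fun (by fun_prop) (by fun_prop)
    rw [gaussianPair, Measure.prod_apply_symm hm]
    simp only [preimage_ofPred_eq, ofPred_eq_eq_singleton, measure_singleton, lintegral_zero]
  refine measure_mono_null_ae ?_ h0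
  filter_upwards [ae_sum_sq_pos_gaussianPair hk] with q hq hx
  have hk' : (0 : ℝ) < k := by exact_mod_cast Nat.pos_of_ne_zero hk
  have hx' : q.1 / √((∑ i, q.2 i ^ 2) / k) = x := hx
  exact (div_eq_iff (by positivity)).1 hx'

lemma isOpenPosMeasure_studentTMeasure {k : ℕ} (hk : k ≠ 0) :
    (studentTMeasure k).IsOpenPosMeasure := by
  have hopen := isOpenPosMeasure_gaussianReal 0 (v := 1) one_ne_zero
  have hpair : (gaussianPair k).IsOpenPosMeasure := by unfold gaussianPair; infer_instance
  have hk' : (0 : ℝ) < k := by exact_mod_cast Nat.pos_of_ne_zero hk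
  refine ⟨fun V hV ⟨x, hx⟩ => ?_⟩
  rw [studentTMeasure_eq_map_studentRatio,
    Measure.map_apply measurable_studentRatio hV.measurableSet]
  have hW : IsOpen {q : ℝ × (Fin k → ℝ) | 0 < ∑ i, q.2 i ^ 2} :=
    isOpen_lt continuous_const (by fun_prop)
  have hcont : ContinuousOn (studentRatio (k := k)) {q | 0 < ∑ i, q.2 i ^ 2} := by
    refine ContinuousOn.div (by fun_prop) (by fun_prop) fun q hq => ?_
    have hq' : 0 < ∑ i, q.2 i ^ 2 := hq
    positivity
  have hne : ({q : ℝ × (Fin k → ℝ) | 0 < ∑ i, q.2 i ^ 2} ∩ studentRatio ⁻¹' V).Nonempty :=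
    -- With all denominator coordinates equal to `1` the mean square is `1`, so the ratio is `x`.
    ⟨(x, fun _ => 1), by simp [hk'], by simpa [studentRatio, hk'.ne'] using hx⟩
  exact fun h => ((hcont.isOpen_inter_preimage hW hV).measure_pos (gaussianPair k) hne).ne'
    (measure_mono_null inter_subset_right h)

/-- The first coordinate of a vector, relative to the norm, in terms of its Student ratio. -/
lemma sqrt_mul_sin_arctan_studentRatio {k : ℕ} {q : ℝ × (Fin k → ℝ)} (hq : 0 < ∑ i, q.2 i ^ 2) :
    √(q.1 ^ 2 + ∑ i, q.2 i ^ 2) * Real.sin (Real.arctan (studentRatio q / √k)) = q.1 := by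
  have hk : (0 : ℝ) < k := by
    rcases Nat.eq_zero_or_pos k with rfl | h
    · simp at hq
    · exact_mod_cast h
  have h1 : studentRatio q / √k = q.1 / √(∑ i, q.2 i ^ 2) := by
    rw [studentRatio, Real.sqrt_div hq.le]
    field_simp
  have h2 : 1 + (q.1 / √(∑ i, q.2 i ^ 2)) ^ 2 =
      (q.1 ^ 2 + ∑ i, q.2 i ^ 2) / ∑ i, q.2 i ^ 2 := by
    rw [div_pow, Real.sq_sqrt hq.le]
    field_simp
    ring
  -- Here `sin (arctan w) = w / √(1 + w²)` with `w` the numerator over the norm of the remaining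
  -- coordinates.
  rw [h1, Real.sin_arctan, h2, Real.sqrt_div (by positivity)]
  have : 0 < √(q.1 ^ 2 + ∑ i, q.2 i ^ 2) := by positivity
  field_simp

lemma monotone_sin_arctan : Monotone fun x : ℝ => Real.sin (Real.arctan x) := fun x y h =>
  Real.strictMonoOn_sin.monotoneOn
    ⟨(Real.neg_pi_div_two_lt_arctan x).le, (Real.arctan_lt_pi_div_two x).le⟩
    ⟨(Real.neg_pi_div_two_lt_arctan y).le, (Real.arctan_lt_pi_div_two y).le⟩
    (Real.arctan_mono h)

lemma map_stdGaussian_eq_gaussianPair (k : ℕ) :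
    (stdGaussian (EuclideanSpace ℝ (Fin (k + 1)))).map (fun z => (z 0, fun i : Fin k => z i.succ)) =
      gaussianPair k := by
  have h := (measurePreserving_piFinSuccAbove (fun _ : Fin (k + 1) => gaussianReal 0 1) 0).map_eq
  rw [← map_pi_eq_stdGaussian, Measure.map_map (by fun_prop) (by fun_prop), gaussianPair, ← h]
  rfl

/-- Under the standard normal law, the norm is independent of the Student ratio. -/
lemma map_norm_studentRatio_gaussianPair (k : ℕ) :
    (gaussianPair k).map (fun q => (√(q.1 ^ 2 + ∑ i, q.2 i ^ 2), studentRatio q)) =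
      ((gaussianPair k).map fun q => √(q.1 ^ 2 + ∑ i, q.2 i ^ 2)).prod (studentTMeasure k) := by
  have hΦ : Measurable fun z : EuclideanSpace ℝ (Fin (k + 1)) =>
      (z 0, fun i : Fin k => z i.succ) := by fun_prop
  have hind := indepFun_norm_stdGaussian (Fin (k + 1)) (measurable_studentRatio.comp hΦ)
    (fun r z hr => by
      have hs : √((∑ i : Fin k, (r * z i.succ) ^ 2) / k) =
          r * √((∑ i : Fin k, z i.succ ^ 2) / k) := by
        simp_rw [mul_pow]
        rw [← Finset.mul_sum, mul_div_assoc, Real.sqrt_mul (sq_nonneg r), Real.sqrt_sq hr.le]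
      simp only [Function.comp_apply, studentRatio, PiLp.smul_apply, smul_eq_mul]
      rw [hs, mul_div_mul_left _ _ hr.ne'])
  rw [indepFun_iff_map_prod_eq_prod_map_map (by fun_prop) (by fun_prop)] at hind
  have hnorm : ∀ z : EuclideanSpace ℝ (Fin (k + 1)),
      √(z 0 ^ 2 + ∑ i : Fin k, z i.succ ^ 2) = ‖z‖ := by
    intro z
    rw [EuclideanSpace.norm_eq, Fin.sum_univ_succ]
    simp
  rw [studentTMeasure_eq_map_studentRatio, ← map_stdGaussian_eq_gaussianPair,
    Measure.map_map (by fun_prop) hΦ, Measure.map_map (by fun_prop) hΦ,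
    Measure.map_map (by fun_prop) hΦ]
  simpa only [Function.comp_def, hnorm] using hind

/-- Density of the noncentral `t`-distribution with respect to the central one. -/
def noncentralTDensity (k : ℕ) (d t : ℝ) : ENNReal :=
  ∫⁻ r, ENNReal.ofReal (Real.exp (d * (r * Real.sin (Real.arctan (t / √k))) - d ^ 2 / 2))
    ∂(gaussianPair k).map fun q => √(q.1 ^ 2 + ∑ i, q.2 i ^ 2)

/-- Shifting the numerator by `d` is an exponential tilt depending on it alone. The numerator is the
norm times a function of the Student ratio, and the norm is independent of that ratio, so
integrating out the norm leaves a density in the ratio. -/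
lemma noncentralTMeasure_eq_withDensity {k : ℕ} (hk : k ≠ 0) (d : ℝ) :
    noncentralTMeasure k d = (studentTMeasure k).withDensity (noncentralTDensity k d) := by
  have hshift : noncentralTMeasure k d =
      ((gaussianPair k).withDensity fun q =>
        ENNReal.ofReal (Real.exp ((d * q.1 - d ^ 2 / 2) / (1 : ℝ≥0)))).map studentRatio := by
    have h1 : (gaussianPair k).map (Prod.map (fun x => x + d) id) =
        (gaussianReal d 1).prod (Measure.pi fun _ : Fin k => gaussianReal 0 1) := by
      rw [gaussianPair, ← Measure.map_prod_map _ _ (by fun_prop) measurable_id, Measure.map_id,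
        gaussianReal_map_add_const, zero_add]
    rw [gaussianReal_eq_withDensity d one_ne_zero, prod_withDensity_left (by fun_prop)] at h1
    rw [gaussianPair, ← h1, Measure.map_map (by fun_prop) (by fun_prop)]
    rfl
  set L := (gaussianPair k).map fun q => √(q.1 ^ 2 + ∑ i, q.2 i ^ 2) with hL
  have hLprob : IsProbabilityMeasure L := Measure.isProbabilityMeasure_map (by fun_prop)
  ext A hA
  have hA' := measurable_studentRatio (k := k) hA
  let F : ℝ × ℝ → ENNReal := fun p => A.indicator 1 p.2 *
    ENNReal.ofReal (Real.exp (d * (p.1 * Real.sin (Real.arctan (p.2 / √k))) - d ^ 2 / 2))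
  have hF : Measurable F := by
    have : Measurable (A.indicator (1 : ℝ → ENNReal)) := measurable_one.indicator hA
    fun_prop
  calc noncentralTMeasure k d A
      = ∫⁻ q, F (√(q.1 ^ 2 + ∑ i, q.2 i ^ 2), studentRatio q) ∂gaussianPair k := by
        rw [hshift, Measure.map_apply measurable_studentRatio hA, withDensity_apply _ hA',
          ← lintegral_indicator hA']
        refine lintegral_congr_ae ?_
        filter_upwards [ae_sum_sq_pos_gaussianPair hk] with q hq
        simp only [F, sqrt_mul_sin_arctan_studentRatio hq, NNReal.coe_one, div_one]
        by_cases h : studentRatio q ∈ A <;> simp [indicator, h]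
    _ = ∫⁻ p, F p ∂L.prod (studentTMeasure k) := by
        rw [← map_norm_studentRatio_gaussianPair, lintegral_map hF (by fun_prop)]
    _ = ∫⁻ t, A.indicator 1 t * noncentralTDensity k d t ∂studentTMeasure k := by
        rw [lintegral_prod_symm' _ hF]
        refine lintegral_congr fun t => ?_
        have hm : Measurable fun r : ℝ => ENNReal.ofReal
            (Real.exp (d * (r * Real.sin (Real.arctan (t / √k))) - d ^ 2 / 2)) := by fun_prop
        exact lintegral_const_mul (μ := L) (A.indicator 1 t) hm
    _ = _ := by
        rw [withDensity_apply _ hA, ← lintegral_indicator hA]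
        refine lintegral_congr fun t => ?_
        by_cases h : t ∈ A <;> simp [indicator, h]

/-- Needed because the exponent of the density contains the factor `d * r`: with `r ≥ 0` its
monotonicity in `t` is decided by the sign of `d`. -/
lemma ae_norm_nonneg (k : ℕ) :
    ∀ᵐ r ∂(gaussianPair k).map fun q => √(q.1 ^ 2 + ∑ i, q.2 i ^ 2), 0 ≤ r :=
  (ae_map_iff (by fun_prop) measurableSet_Ici).2 (.of_forall fun _ => Real.sqrt_nonneg _)

lemma monotone_noncentralTDensity (k : ℕ) {d : ℝ} (hd : 0 ≤ d) :
    Monotone (noncentralTDensity k d) := by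
  intro s t h
  refine lintegral_mono_ae ?_
  filter_upwards [ae_norm_nonneg k] with r hr
  have h1 := monotone_sin_arctan (div_le_div_of_nonneg_right h (Real.sqrt_nonneg k))
  dsimp only at h1
  gcongr

lemma antitone_noncentralTDensity (k : ℕ) {d : ℝ} (hd : d ≤ 0) :
    Antitone (noncentralTDensity k d) := by
  intro s t h
  refine lintegral_mono_ae ?_
  filter_upwards [ae_norm_nonneg k] with r hr
  have h1 := mul_le_mul_of_nonneg_left
    (monotone_sin_arctan (div_le_div_of_nonneg_right h (Real.sqrt_nonneg k))) hr
  have h2 := mul_le_mul_of_nonpos_left h1 hd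
  dsimp only at h2
  gcongr ENNReal.ofReal (Real.exp (?_ - _))

/-! ### Two-sample means comparison model -/

/-- The omitted coordinate `1` will be the direction of the pooled mean, on which the `t`-statistic
does not depend. -/
lemma map_stdGaussian_eq_gaussianPair_succ (k : ℕ) :
    (stdGaussian (EuclideanSpace ℝ (Fin (k + 2)))).map
      (fun z => (z 0, fun i : Fin k => z i.succ.succ)) = gaussianPair k := by
  have htail : (Measure.pi fun _ : Fin (k + 1) => gaussianReal 0 1).map
      (fun w (i : Fin k) => w i.succ) = Measure.pi fun _ : Fin k => gaussianReal 0 1 := by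
    have h := (measurePreserving_snd.comp
      (measurePreserving_piFinSuccAbove (fun _ : Fin (k + 1) => gaussianReal 0 1) 0)).map_eq
    exact h
  have h1 : (gaussianPair (k + 1)).map (Prod.map id fun w (i : Fin k) => w i.succ) =
      gaussianPair k := by
    rw [gaussianPair, ← Measure.map_prod_map _ _ measurable_id (by fun_prop), htail,
      Measure.map_id, gaussianPair]
  rw [← h1, ← map_stdGaussian_eq_gaussianPair, Measure.map_map (by fun_prop) (by fun_prop)]
  rfl

/-! ### Algebra of sample means, pooled variance and the `t`-statistic. -/

section Algebra

variable {Ω : Type*} {k l : ℕ}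

lemma sum_eq_mul_sampleMean (hk : k ≠ 0) (X : Fin k → Ω → ℝ) (ω : Ω) :
    ∑ i, X i ω = k * sampleMean X ω := by
  have : (k : ℝ) ≠ 0 := by exact_mod_cast hk
  rw [sampleMean]
  field_simp

lemma sum_sub_sampleMean_sq (hk : k ≠ 0) (X : Fin k → Ω → ℝ) (ω : Ω) :
    ∑ i, (X i ω - sampleMean X ω) ^ 2 = ∑ i, X i ω ^ 2 - k * sampleMean X ω ^ 2 := by
  simp only [sub_sq, Finset.sum_add_distrib, Finset.sum_sub_distrib, ← Finset.sum_mul,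
    ← Finset.mul_sum, Finset.sum_const, Finset.card_univ, Fintype.card_fin, nsmul_eq_mul]
  rw [sum_eq_mul_sampleMean hk X ω]
  ring

lemma sampleMean_affine (hk : k ≠ 0) (X : Fin k → Ω → ℝ) (a s : ℝ) (ω : Ω) :
    sampleMean (fun i ω => a + s * X i ω) ω = a + s * sampleMean X ω := by
  have : (k : ℝ) ≠ 0 := by exact_mod_cast hk
  simp only [sampleMean, Finset.sum_add_distrib, ← Finset.mul_sum, Finset.sum_const,
    Finset.card_univ, Fintype.card_fin, nsmul_eq_mul]
  field_simp

lemma pooledVar_affine (hk : k ≠ 0) (hl : l ≠ 0) (X : Fin k → Ω → ℝ) (Y : Fin l → Ω → ℝ)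
    (a b s : ℝ) (ω : Ω) :
    pooledVar (fun i ω => a + s * X i ω) (fun i ω => b + s * Y i ω) ω =
      s ^ 2 * pooledVar X Y ω := by
  simp only [pooledVar, sampleMean_affine hk, sampleMean_affine hl, add_sub_add_left_eq_sub,
    ← mul_sub, mul_pow, ← Finset.mul_sum]
  ring

/-- The common scale `s > 0` cancels between numerator and denominator; the difference of shifts
survives as the noncentrality. -/
lemma tStat_affine (hk : k ≠ 0) (hl : l ≠ 0) (X : Fin k → Ω → ℝ) (Y : Fin l → Ω → ℝ)
    (a b : ℝ) {s : ℝ} (hs : 0 < s) (ω : Ω) :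
    tStat (fun i ω => a + s * X i ω) (fun i ω => b + s * Y i ω) ω =
      (√((k : ℝ) * l / (k + l)) * (sampleMean X ω - sampleMean Y ω) +
        √((k : ℝ) * l / (k + l)) * (a - b) / s) / √(pooledVar X Y ω) := by
  rw [tStat, pooledVar_affine hk hl, sampleMean_affine hk, sampleMean_affine hl,
    Real.sqrt_mul (sq_nonneg s), Real.sqrt_sq hs.le, ← mul_div_mul_left _ (√(pooledVar X Y ω)) hs.ne']
  congr 1
  field_simp
  ring

end Algebra

/-! ### Orthonormal coordinates adapted to two samples. -/

/-- Standardized linear functional that compares the means of two samples. -/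
def contrastVector (k l : ℕ) : EuclideanSpace ℝ (Fin k ⊕ Fin l) :=
  WithLp.toLp 2 (Sum.elim (fun _ => √((k : ℝ) * l / (k + l)) / k)
    (fun _ => -(√((k : ℝ) * l / (k + l)) / l)))

/-- Standardized linear functional proportional to the mean of the pooled sample. -/
def totalVector (k l : ℕ) : EuclideanSpace ℝ (Fin k ⊕ Fin l) :=
  WithLp.toLp 2 fun _ => (√((k : ℝ) + l))⁻¹

section Basis

variable {k l : ℕ}

lemma inner_contrastVector (z : EuclideanSpace ℝ (Fin k ⊕ Fin l)) :
    inner ℝ (contrastVector k l) z = √((k : ℝ) * l / (k + l)) *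
      (sampleMean (fun i (x : Fin k ⊕ Fin l → ℝ) => x (Sum.inl i)) z.ofLp -
        sampleMean (fun i (x : Fin k ⊕ Fin l → ℝ) => x (Sum.inr i)) z.ofLp) := by
  simp only [PiLp.inner_apply, contrastVector, Fintype.sum_sum_type, Sum.elim_inl, Sum.elim_inr,
    RCLike.inner_apply, conj_trivial, sampleMean, ← Finset.sum_mul]
  ring

lemma inner_totalVector (hk : k ≠ 0) (hl : l ≠ 0) (z : EuclideanSpace ℝ (Fin k ⊕ Fin l)) :
    inner ℝ (totalVector k l) z = (√((k : ℝ) + l))⁻¹ *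
      (k * sampleMean (fun i (x : Fin k ⊕ Fin l → ℝ) => x (Sum.inl i)) z.ofLp +
        l * sampleMean (fun i (x : Fin k ⊕ Fin l → ℝ) => x (Sum.inr i)) z.ofLp) := by
  rw [← sum_eq_mul_sampleMean hk, ← sum_eq_mul_sampleMean hl]
  simp only [PiLp.inner_apply, totalVector, Fintype.sum_sum_type,
    RCLike.inner_apply, conj_trivial, ← Finset.sum_mul]
  ring

lemma norm_contrastVector (hk : k ≠ 0) (hl : l ≠ 0) : ‖contrastVector k l‖ = 1 := by
  have hk' : (0 : ℝ) < k := by exact_mod_cast Nat.pos_of_ne_zero hk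
  have hl' : (0 : ℝ) < l := by exact_mod_cast Nat.pos_of_ne_zero hl
  rw [EuclideanSpace.norm_eq, Real.sqrt_eq_one]
  simp only [contrastVector, Fintype.sum_sum_type, Sum.elim_inl, Sum.elim_inr,
    Real.norm_eq_abs, sq_abs, neg_sq, div_pow, Finset.sum_const, Finset.card_univ, Fintype.card_fin,
    nsmul_eq_mul]
  rw [Real.sq_sqrt (by positivity)]
  field_simp
  ring

lemma norm_totalVector (hk : k ≠ 0) : ‖totalVector k l‖ = 1 := by
  have hk' : (0 : ℝ) < k := by exact_mod_cast Nat.pos_of_ne_zero hk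
  rw [EuclideanSpace.norm_eq, Real.sqrt_eq_one]
  simp only [totalVector, Real.norm_eq_abs, sq_abs, inv_pow, Finset.sum_const, Finset.card_univ,
    Fintype.card_sum, Fintype.card_fin, nsmul_eq_mul]
  rw [Real.sq_sqrt (by positivity)]
  push_cast
  field_simp

lemma inner_contrastVector_totalVector (hk : k ≠ 0) (hl : l ≠ 0) :
    inner ℝ (contrastVector k l) (totalVector k l) = 0 := by
  have hk' : (k : ℝ) ≠ 0 := by exact_mod_cast hk
  have hl' : (l : ℝ) ≠ 0 := by exact_mod_cast hl
  rw [inner_contrastVector]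
  simp only [totalVector, sampleMean, Finset.sum_const, Finset.card_univ, Fintype.card_fin,
    nsmul_eq_mul]
  field_simp
  ring

/-- The index type `Fin (k + l - 2 + 2)` lets `succ.succ` enumerate the residual coordinates, one
for each degree of freedom. -/
lemma exists_orthonormalBasis_contrastVector (hk : k ≠ 0) (hl : l ≠ 0) (hkl : 2 ≤ k + l) :
    ∃ b : OrthonormalBasis (Fin (k + l - 2 + 2)) ℝ (EuclideanSpace ℝ (Fin k ⊕ Fin l)),
      b 0 = contrastVector k l ∧ b 1 = totalVector k l := by
  -- Only the restriction of `v` to `{0, 1}` is extended to a basis; its other values play no role.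
  let v : Fin (k + l - 2 + 2) → EuclideanSpace ℝ (Fin k ⊕ Fin l) := fun i =>
    if i = 0 then contrastVector k l else totalVector k l
  have hv0 : v 0 = contrastVector k l := if_pos rfl
  have hv1 : v 1 = totalVector k l := if_neg (by simp)
  have hc := inner_contrastVector_totalVector hk hl
  have hv : Orthonormal ℝ (({0, 1} : Set (Fin (k + l - 2 + 2))).domRestrict v) := by
    constructor
    · rintro ⟨i, rfl | rfl⟩
      · simpa [hv0] using norm_contrastVector hk hl
      · simpa [hv1] using norm_totalVector hk
    · rintro ⟨i, rfl | rfl⟩ ⟨j, rfl | rfl⟩ hij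
      · exact absurd rfl hij
      · simpa [hv0, hv1] using hc
      · simpa [hv0, hv1, real_inner_comm] using hc
      · exact absurd rfl hij
  obtain ⟨b, hb⟩ := hv.exists_orthonormalBasis_extension_of_card_eq (by simp; omega)
  exact ⟨b, (hb 0 (by simp)).trans hv0, (hb 1 (by simp)).trans hv1⟩

/-- The residual sum of squares in orthonormal coordinates. -/
lemma sum_repr_sq_eq (hk : k ≠ 0) (hl : l ≠ 0)
    (b : OrthonormalBasis (Fin (k + l - 2 + 2)) ℝ (EuclideanSpace ℝ (Fin k ⊕ Fin l)))
    (h0 : b 0 = contrastVector k l) (h1 : b 1 = totalVector k l)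
    (z : EuclideanSpace ℝ (Fin k ⊕ Fin l)) :
    ∑ i : Fin (k + l - 2), b.repr z i.succ.succ ^ 2 =
      ∑ i, (z.ofLp (Sum.inl i) -
          sampleMean (fun i (x : Fin k ⊕ Fin l → ℝ) => x (Sum.inl i)) z.ofLp) ^ 2 +
        ∑ i, (z.ofLp (Sum.inr i) -
          sampleMean (fun i (x : Fin k ⊕ Fin l → ℝ) => x (Sum.inr i)) z.ofLp) ^ 2 := by
  have hk' : (0 : ℝ) < k := by exact_mod_cast Nat.pos_of_ne_zero hk
  have hl' : (0 : ℝ) < l := by exact_mod_cast Nat.pos_of_ne_zero hl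
  -- Parseval: the residual coordinates carry the squared norm minus the squares of the first two
  -- coordinates.
  have hnorm : ‖b.repr z‖ ^ 2 = ‖z‖ ^ 2 := by rw [LinearIsometryEquiv.norm_map]
  rw [EuclideanSpace.norm_sq_eq, EuclideanSpace.norm_sq_eq, Fin.sum_univ_succ, Fin.sum_univ_succ,
    Fintype.sum_sum_type] at hnorm
  simp only [Real.norm_eq_abs, sq_abs, Fin.succ_zero_eq_one] at hnorm
  have e0 : b.repr z 0 = _ := (b.repr_apply_apply z 0).trans (h0 ▸ inner_contrastVector z)
  have e1 : b.repr z 1 = _ := (b.repr_apply_apply z 1).trans (h1 ▸ inner_totalVector hk hl z)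
  rw [sum_sub_sampleMean_sq hk (fun i (x : Fin k ⊕ Fin l → ℝ) => x (Sum.inl i)),
    sum_sub_sampleMean_sq hl (fun i (x : Fin k ⊕ Fin l → ℝ) => x (Sum.inr i))]
  rw [e0, e1, mul_pow, mul_pow, inv_pow, Real.sq_sqrt (by positivity),
    Real.sq_sqrt (by positivity)] at hnorm
  -- The squared contrast and total coordinates add up to the parts `k x² + l y²` due to the two
  -- sample means.
  have hid : ∀ x y : ℝ, (k : ℝ) * l / (k + l) * (x - y) ^ 2 +
      ((k : ℝ) + l)⁻¹ * (k * x + l * y) ^ 2 = k * x ^ 2 + l * y ^ 2 := by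
    intro x y
    field_simp
    ring
  linarith [hid (sampleMean (fun i (x : Fin k ⊕ Fin l → ℝ) => x (Sum.inl i)) z.ofLp)
    (sampleMean (fun i (x : Fin k ⊕ Fin l → ℝ) => x (Sum.inr i)) z.ofLp)]

/-- The two-sample `t`-statistic is a Student ratio in orthonormal coordinates. -/
lemma tStat_eq_studentRatio (hk : k ≠ 0) (hl : l ≠ 0) (hkl : 2 ≤ k + l)
    (b : OrthonormalBasis (Fin (k + l - 2 + 2)) ℝ (EuclideanSpace ℝ (Fin k ⊕ Fin l)))
    (h0 : b 0 = contrastVector k l) (h1 : b 1 = totalVector k l) (a₁ a₂ : ℝ) {s : ℝ} (hs : 0 < s)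
    (z : EuclideanSpace ℝ (Fin k ⊕ Fin l)) :
    tStat (fun i (x : Fin k ⊕ Fin l → ℝ) => a₁ + s * x (Sum.inl i))
        (fun i (x : Fin k ⊕ Fin l → ℝ) => a₂ + s * x (Sum.inr i)) z.ofLp =
      studentRatio (b.repr z 0 + √((k : ℝ) * l / (k + l)) * (a₁ - a₂) / s,
        fun i : Fin (k + l - 2) => b.repr z i.succ.succ) := by
  have e0 : b.repr z 0 = _ := (b.repr_apply_apply z 0).trans (h0 ▸ inner_contrastVector z)
  rw [tStat_affine hk hl (fun i (x : Fin k ⊕ Fin l → ℝ) => x (Sum.inl i))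
    (fun i (x : Fin k ⊕ Fin l → ℝ) => x (Sum.inr i)) a₁ a₂ hs, studentRatio, e0,
    sum_repr_sq_eq hk hl b h0 h1, pooledVar, Nat.cast_sub hkl, one_div_mul_eq_div]
  push_cast
  rfl

end Basis

/-! ### Law of the two-sample `t`-statistic and conclusion for this model. -/

lemma measurable_pooledVar {Ω : Type*} [MeasurableSpace Ω] {k l : ℕ} {X : Fin k → Ω → ℝ}
    {Y : Fin l → Ω → ℝ} (hX : ∀ i, Measurable (X i)) (hY : ∀ i, Measurable (Y i)) :
    Measurable (pooledVar X Y) := by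
  have h1 := measurable_sampleMean hX
  have h2 := measurable_sampleMean hY
  unfold pooledVar
  fun_prop

lemma measurable_tStat {Ω : Type*} [MeasurableSpace Ω] {k l : ℕ} {X : Fin k → Ω → ℝ}
    {Y : Fin l → Ω → ℝ} (hX : ∀ i, Measurable (X i)) (hY : ∀ i, Measurable (Y i)) :
    Measurable (tStat X Y) := by
  have h1 := measurable_sampleMean hX
  have h2 := measurable_sampleMean hY
  have h3 := measurable_pooledVar hX hY
  unfold tStat
  fun_prop

/-- The two-sample `t`-statistic has a noncentral `t`-distribution. -/
theorem map_tStat_eq_noncentralTMeasure {Ω : Type*} [MeasurableSpace Ω] {P : Measure Ω}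
    [IsProbabilityMeasure P] {k l : ℕ} (hk : k ≠ 0) (hl : l ≠ 0) (hkl : 2 ≤ k + l)
    {X : Fin k → Ω → ℝ} {Y : Fin l → Ω → ℝ} (hX : ∀ i, Measurable (X i))
    (hY : ∀ i, Measurable (Y i)) (hind : iIndepFun (Sum.elim X Y : Fin k ⊕ Fin l → Ω → ℝ) P)
    {a₁ a₂ : ℝ} {v : ℝ≥0} (hv : 0 < v) (hXlaw : ∀ i, P.map (X i) = gaussianReal a₁ v)
    (hYlaw : ∀ i, P.map (Y i) = gaussianReal a₂ v) :
    P.map (tStat X Y) =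
      noncentralTMeasure (k + l - 2) (√((k : ℝ) * l / (k + l)) * (a₁ - a₂) / √v) := by
  obtain ⟨b, h0, h1⟩ := exists_orthonormalBasis_contrastVector hk hl hkl
  have hs : 0 < √(v : ℝ) := Real.sqrt_pos.2 (by exact_mod_cast hv)
  let D : Ω → Fin k ⊕ Fin l → ℝ := fun ω i => (Sum.elim X Y : Fin k ⊕ Fin l → Ω → ℝ) i ω
  have hDm : ∀ i, Measurable ((Sum.elim X Y : Fin k ⊕ Fin l → Ω → ℝ) i) :=
    Sum.rec hX hY
  -- Standardization: the data are distributed as the affine image under `A` of a standard normal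
  -- vector.
  let A : (Fin k ⊕ Fin l → ℝ) → Fin k ⊕ Fin l → ℝ := fun x i =>
    Sum.elim (fun _ => a₁) (fun _ => a₂) i + √(v : ℝ) * x i
  have haffine : ∀ a : ℝ, (gaussianReal 0 1).map (fun x => a + √(v : ℝ) * x) =
      gaussianReal a v := by
    intro a
    have : (fun x => a + √(v : ℝ) * x) = (fun x => a + x) ∘ (fun x => √(v : ℝ) * x) := rfl
    rw [this, ← Measure.map_map (by fun_prop) (by fun_prop), gaussianReal_map_const_mul,
      gaussianReal_map_const_add]
    congr 1
    · ring
    · ext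
      simp
  have hD : P.map D = (Measure.pi fun _ => gaussianReal 0 1).map A := by
    have hpi : (Measure.pi fun _ => gaussianReal 0 1).map A = Measure.pi fun i =>
        (gaussianReal 0 1).map fun x => Sum.elim (fun _ => a₁) (fun _ => a₂) i + √(v : ℝ) * x := by
      have := fun i : Fin k ⊕ Fin l => Measure.isProbabilityMeasure_map (μ := gaussianReal 0 1)
        (f := fun x => Sum.elim (fun _ => a₁) (fun _ => a₂) i + √(v : ℝ) * x) (by fun_prop)
      exact Measure.pi_map_pi (μ := fun _ => gaussianReal 0 1)
        (f := fun i x => Sum.elim (fun _ => a₁) (fun _ => a₂) i + √(v : ℝ) * x)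
        fun i => by fun_prop
    rw [(iIndepFun_iff_map_fun_eq_pi_map fun i => (hDm i).aemeasurable).1 hind, hpi]
    congr 1
    ext1 i
    rcases i with i | i
    · simp [hXlaw, haffine]
    · simp [hYlaw, haffine]
  have hτ : Measurable (tStat (fun i (x : Fin k ⊕ Fin l → ℝ) => x (Sum.inl i))
      (fun i (x : Fin k ⊕ Fin l → ℝ) => x (Sum.inr i))) :=
    measurable_tStat (fun i => measurable_pi_apply _) (fun i => measurable_pi_apply _)
  have hA : Measurable A := by fun_prop
  have hDmeas : Measurable D := measurable_pi_lambda _ hDm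
  calc P.map (tStat X Y)
      = (P.map D).map (tStat (fun i (x : Fin k ⊕ Fin l → ℝ) => x (Sum.inl i))
          (fun i (x : Fin k ⊕ Fin l → ℝ) => x (Sum.inr i))) := by
        rw [Measure.map_map hτ hDmeas]
        rfl
    _ = (Measure.pi fun _ => gaussianReal 0 1).map
          (tStat (fun i (x : Fin k ⊕ Fin l → ℝ) => a₁ + √v * x (Sum.inl i))
            (fun i (x : Fin k ⊕ Fin l → ℝ) => a₂ + √v * x (Sum.inr i))) := by
        rw [hD, Measure.map_map hτ hA]
        rfl
    _ = (Measure.pi fun _ => gaussianReal 0 1).map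
          ((fun y : EuclideanSpace ℝ (Fin (k + l - 2 + 2)) =>
            studentRatio (y 0 + √((k : ℝ) * l / (k + l)) * (a₁ - a₂) / √v,
              fun i : Fin (k + l - 2) => y i.succ.succ)) ∘ b.repr ∘ WithLp.toLp 2) := by
        congr 1
        ext x
        exact tStat_eq_studentRatio hk hl hkl b h0 h1 a₁ a₂ hs (WithLp.toLp 2 x)
    _ = (stdGaussian (EuclideanSpace ℝ (Fin (k + l - 2 + 2)))).map
          (fun y : EuclideanSpace ℝ (Fin (k + l - 2 + 2)) =>
            studentRatio (y 0 + √((k : ℝ) * l / (k + l)) * (a₁ - a₂) / √v,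
              fun i : Fin (k + l - 2) => y i.succ.succ)) := by
        -- Rotation invariance: the coordinates in the basis `b` are again independent standard
        -- normal.
        rw [← stdGaussian_map b.repr, ← map_pi_eq_stdGaussian,
          Measure.map_map (by fun_prop) (by fun_prop), Measure.map_map (by fun_prop) (by fun_prop)]
        rfl
    _ = _ := by
        rw [noncentralTMeasure, ← map_stdGaussian_eq_gaussianPair_succ,
          Measure.map_map (by fun_prop) (by fun_prop)]
        rfl

theorem stochLE_pRand_tPLFC {Ω N : Type*} [MeasurableSpace Ω] {m : ℕ} {n₁ n₂ : Fin m → ℕ}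
    {P : TwoSampleParam m × N → Measure Ω} {X : (j : Fin m) → Fin (n₁ j) → Ω → ℝ}
    {Y : (j : Fin m) → Fin (n₂ j) → Ω → ℝ} {U : Fin m → Ω → ℝ}
    (hXY : IsTwoSampleModel n₁ n₂ P X Y)
    (hU : ∀ ϑ, IsRandomizer (P ϑ)
      (fun ω => ((fun j i => X j i ω : (j : Fin m) → Fin (n₁ j) → ℝ),
        (fun j i => Y j i ω : (j : Fin m) → Fin (n₂ j) → ℝ))) U) (j : Fin m) {c : ℝ}
    (hc : c ∈ Icc (0 : ℝ) 1) :
    (∀ ϑ : TwoSampleParam m × N, ϑ.1.diff j ∈ Iic (0 : ℝ) →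
      StochLE (P ϑ) (U j) (fun ω => pRand (tPLFC n₁ n₂ P X Y j ω) (U j ω) c) ∧
      StochLE (P ϑ) (fun ω => pRand (tPLFC n₁ n₂ P X Y j ω) (U j ω) c)
        (tPLFC n₁ n₂ P X Y j)) ∧
    (∀ ϑ : TwoSampleParam m × N, ϑ.1.diff j ∈ Ioi (0 : ℝ) →
      StochLE (P ϑ) (tPLFC n₁ n₂ P X Y j)
        (fun ω => pRand (tPLFC n₁ n₂ P X Y j ω) (U j ω) c) ∧
      StochLE (P ϑ) (fun ω => pRand (tPLFC n₁ n₂ P X Y j ω) (U j ω) c) (U j)) := by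
  rcases isEmpty_or_nonempty N with hN | hN
  · exact ⟨fun ϑ => isEmptyElim ϑ.2, fun ϑ => isEmptyElim ϑ.2⟩
  obtain ⟨η⟩ := hN
  have hprob := hXY.isProb
  have hn₁ : n₁ j ≠ 0 := Nat.one_le_iff_ne_zero.1 (hXY.size₁_pos j)
  have hn₂ : n₂ j ≠ 0 := Nat.one_le_iff_ne_zero.1 (hXY.size₂_pos j)
  have hdf3 := hXY.df_pos j
  have hdf : n₁ j + n₂ j - 2 ≠ 0 := by omega
  have hopen := isOpenPosMeasure_studentTMeasure hdf
  have hsing := nullSingletonClass_studentTMeasure hdf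
  -- The noncentrality parameter: the variance is positive, so `δ` is nonpositive under the null and
  -- nonnegative under the alternative.
  let δ : TwoSampleParam m × N → ℝ := fun ϑ =>
    √((n₁ j : ℝ) * n₂ j / (n₁ j + n₂ j)) * ϑ.1.diff j / √(ϑ.1.var j)
  have hlaw : ∀ ϑ, (P ϑ).map (tStat (X j) (Y j)) = noncentralTMeasure (n₁ j + n₂ j - 2) (δ ϑ) :=
    fun ϑ => map_tStat_eq_noncentralTMeasure hn₁ hn₂ (by omega) (hXY.measurable_X j)
      (hXY.measurable_Y j) (hXY.iIndep ϑ j) (ϑ.1.var_pos j) (hXY.law_X ϑ j) (hXY.law_Y ϑ j)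
  -- A least favorable parameter: equal means make the noncentrality vanish, whatever the variance.
  let ϑ₀ : TwoSampleParam m := ⟨fun _ => 0, fun _ => 0, fun _ => 1, fun _ => one_pos⟩
  have hstat : Measurable fun p : ((j : Fin m) → Fin (n₁ j) → ℝ) × ((j : Fin m) → Fin (n₂ j) → ℝ) =>
      tStat (fun i p => p.1 j i) (fun i p => p.2 j i) p :=
    measurable_tStat (fun i => by fun_prop) (fun i => by fun_prop)
  have key := stochLE_pRand_pLFC P {ϑ | ϑ.1.diff j ∈ Iic (0 : ℝ)}
    (studentTMeasure (n₁ j + n₂ j - 2))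
    (measurable_tStat (hXY.measurable_X j) (hXY.measurable_Y j))
    ((hU (ϑ₀, η)).measurable j)
    (fun ϑ => (hU ϑ).indep_data.comp hstat (measurable_pi_apply j))
    (fun ϑ => (hU ϑ).uniform j)
    (fun ϑ => by
      rw [hlaw, noncentralTMeasure_eq_withDensity hdf]
      exact withDensity_absolutelyContinuous _ _)
    (fun ϑ hϑ => by
      have hδ : δ ϑ ≤ 0 := div_nonpos_of_nonpos_of_nonneg
        (mul_nonpos_of_nonneg_of_nonpos (Real.sqrt_nonneg _) hϑ) (Real.sqrt_nonneg _)
      rw [hlaw, noncentralTMeasure_eq_withDensity hdf]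
      exact likelihoodRatioLE_withDensity_of_antitone _ (antitone_noncentralTDensity _ hδ))
    (fun ϑ hϑ => by
      have hδ : 0 ≤ δ ϑ := div_nonneg
        (mul_nonneg (Real.sqrt_nonneg _) (not_le.1 hϑ).le) (Real.sqrt_nonneg _)
      rw [hlaw, noncentralTMeasure_eq_withDensity hdf]
      exact likelihoodRatioLE_withDensity_of_monotone _ (monotone_noncentralTDensity _ hδ))
    (fun _ => ⟨(ϑ₀, η), by simp [ϑ₀, TwoSampleParam.diff], by
      rw [hlaw, studentTMeasure_eq_noncentralTMeasure]
      simp [δ, ϑ₀, TwoSampleParam.diff]⟩) hc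
  exact ⟨key.1, fun ϑ (hϑ : 0 < ϑ.1.diff j) => key.2 ϑ fun h => hϑ.not_ge h⟩

end

theorem mainTheorem4 {Ω N : Type*} [MeasurableSpace Ω] {m : ℕ} :
    (∀ (n : Fin m → ℕ) (P : (Fin m → ℝ) × N → Measure Ω)
        (X : (j : Fin m) → Fin (n j) → Ω → ℝ) (U : Fin m → Ω → ℝ),
      IsZTestsModel n P X →
      (∀ ϑ, IsRandomizer (P ϑ) (fun ω j i => X j i ω) U) →
      ∀ (j : Fin m) (c : ℝ), c ∈ Set.Icc (0 : ℝ) 1 →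
        (∀ ϑ : (Fin m → ℝ) × N, ϑ.1 j ∈ Set.Iic (0 : ℝ) →
          StochLE (P ϑ) (U j) (fun ω => pRand (zPLFC n P X j ω) (U j ω) c) ∧
          StochLE (P ϑ) (fun ω => pRand (zPLFC n P X j ω) (U j ω) c) (zPLFC n P X j)) ∧
        (∀ ϑ : (Fin m → ℝ) × N, ϑ.1 j ∈ Set.Ioi (0 : ℝ) →
          StochLE (P ϑ) (zPLFC n P X j) (fun ω => pRand (zPLFC n P X j ω) (U j ω) c) ∧
          StochLE (P ϑ) (fun ω => pRand (zPLFC n P X j ω) (U j ω) c) (U j))) ∧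
    (∀ (n₁ n₂ : Fin m → ℕ) (P : TwoSampleParam m × N → Measure Ω)
        (X : (j : Fin m) → Fin (n₁ j) → Ω → ℝ) (Y : (j : Fin m) → Fin (n₂ j) → Ω → ℝ)
        (U : Fin m → Ω → ℝ),
      IsTwoSampleModel n₁ n₂ P X Y →
      (∀ ϑ, IsRandomizer (P ϑ)
        (fun ω => ((fun j i => X j i ω : (j : Fin m) → Fin (n₁ j) → ℝ),
          (fun j i => Y j i ω : (j : Fin m) → Fin (n₂ j) → ℝ))) U) →
      ∀ (j : Fin m) (c : ℝ), c ∈ Set.Icc (0 : ℝ) 1 →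
        (∀ ϑ : TwoSampleParam m × N, ϑ.1.diff j ∈ Set.Iic (0 : ℝ) →
          StochLE (P ϑ) (U j) (fun ω => pRand (tPLFC n₁ n₂ P X Y j ω) (U j ω) c) ∧
          StochLE (P ϑ) (fun ω => pRand (tPLFC n₁ n₂ P X Y j ω) (U j ω) c)
            (tPLFC n₁ n₂ P X Y j)) ∧
        (∀ ϑ : TwoSampleParam m × N, ϑ.1.diff j ∈ Set.Ioi (0 : ℝ) →
          StochLE (P ϑ) (tPLFC n₁ n₂ P X Y j)
            (fun ω => pRand (tPLFC n₁ n₂ P X Y j ω) (U j ω) c) ∧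
          StochLE (P ϑ) (fun ω => pRand (tPLFC n₁ n₂ P X Y j ω) (U j ω) c) (U j))) := by
  exact ⟨fun _ _ _ _ hX hU j _ hc => stochLE_pRand_zPLFC hX hU j hc,
    fun _ _ _ _ _ _ hXY hU j _ hc => stochLE_pRand_tPLFC hXY hU j hc⟩
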